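/- Let $a,\rho_0,K,M,S,L>0$ and let $\mathcal H=L^2(\mathbb R)\oplus L^2(\mathbb R)\oplus\ell^2(\mathbb Z)\oplus\ell^2(\mathbb Z)$ (complex spaces) be the Hilbert space with scalar product $$\langle\langle\Psi_1,\Psi_2\rangle\rangle=\frac1{a^2\rho_0}\langle p_1,p_2\rangle+\rho_0\langle v_1,v_2\rangle+\frac KS\langle y_1,y_2\rangle+\frac MS\langle z_1,z_2\rangle ,\qquad \Psi_i=(p_i,v_i,y_i,z_i).$$ Let $$D(\hat A)=\Big\{(p,v,y,z)\in\mathcal H:\ p\in H^1(\mathbb R\setminus L\mathbb Z),\ v\in H^1(\mathbb R),\ \exists\,\sigma\in\ell^2(\mathbb Z)\ \forall n\in\mathbb Z:\ p(nL^+)-p(nL^-)=\sigma_n,\ v(nL)=z_n\Big\}$$ (point values and one-sided limits are those of the representatives of $v$, $p$ continuous on $\mathbb R$ and on $\mathbb R\setminus L\mathbb Z$ respectively). For $(p,v,y,z)\in D(\hat A)$ define the regular part of $p$ by $$p_0(x)=p(x)-\frac12\sum_{n\in\mathbb Z}\sigma_n\big(\mathrm{sgn}(x-nL)-\mathrm{sgn}(0-nL)\big),$$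 a sum with finitely many nonzero terms for each $x$. Then $p_0$ is locally square integrable and has a square integrable weak derivative on $\mathbb R$, and the operator $\hat A:D(\hat A)\to\mathcal H$, $$\hat A(p,v,y,z)=\Big(-a^2\rho_0\frac{dv}{dx},\ -\frac1{\rho_0}\frac{dp_0}{dx},\ z,\ -\frac KM y-\frac SM\sigma\Big)$$ (weak derivatives on $\mathbb R$), is well defined, real (its domain is invariant under complex conjugation and it maps real elements of its domain to real elements) and skew-adjoint on $\mathcal H$ (it is densely defined and $\hat A^*=-\hat A$). -/

import Mathlib

open MeasureTheory Filter Topology Set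
open scoped ENNReal ContDiff

noncomputable section

/-! ### Physical parameters and the weighted Hilbert space -/

/-- The positive physical constants: sound speed `a`, equilibrium density `ρ₀`, spring constant `K`
and mass `M` of every oscillator, area `S` of the section of the pipe, lattice spacing `L`. -/
structure AcousticParams where
  a : ℝ
  ρ₀ : ℝ
  K : ℝ
  M : ℝ
  S : ℝ
  L : ℝ
  a_pos : 0 < a
  ρ₀_pos : 0 < ρ₀
  K_pos : 0 < K
  M_pos : 0 < M
  S_pos : 0 < S
  L_pos : 0 < L

/-- Complex `L²(ℝ)`. -/
abbrev L2R : Type := Lp ℂ 2 (volume : Measure ℝ)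

/-- Complex `ℓ²(ℤ)`. -/
abbrev ell2Z : Type := lp (fun _ : ℤ => ℂ) 2

/-- The vector space `L²(ℝ) ⊕ L²(ℝ) ⊕ ℓ²(ℤ) ⊕ ℓ²(ℤ)`, which will carry the energy scalar product
attached to the parameters `P`. -/
def AcousticSpace (_P : AcousticParams) : Type := L2R × L2R × ell2Z × ell2Z

namespace AcousticSpace

variable {P : AcousticParams}

instance : AddCommGroup (AcousticSpace P) :=
  inferInstanceAs (AddCommGroup (L2R × L2R × ell2Z × ell2Z))

instance : Module ℂ (AcousticSpace P) :=
  inferInstanceAs (Module ℂ (L2R × L2R × ell2Z × ell2Z))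

/-- Pressure field. -/
def p (Ψ : AcousticSpace P) : L2R := Prod.fst Ψ

/-- Velocity field. -/
def v (Ψ : AcousticSpace P) : L2R := Prod.fst (Prod.snd Ψ)

/-- Displacements of the oscillators. -/
def y (Ψ : AcousticSpace P) : ell2Z := Prod.fst (Prod.snd (Prod.snd Ψ))

/-- Velocities of the oscillators. -/
def z (Ψ : AcousticSpace P) : ell2Z := Prod.snd (Prod.snd (Prod.snd Ψ))

/-- The vector `(p, v, y, z)`. -/
def mk (p v : L2R) (y z : ell2Z) : AcousticSpace P := (p, v, y, z)

@[ext] theorem ext {Ψ Φ : AcousticSpace P} (h1 : Ψ.p = Φ.p) (h2 : Ψ.v = Φ.v) (h3 : Ψ.y = Φ.y)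
    (h4 : Ψ.z = Φ.z) : Ψ = Φ :=
  Prod.ext h1 (Prod.ext h2 (Prod.ext h3 h4))

@[simp] theorem p_mk (p v : L2R) (y z : ell2Z) : (mk p v y z : AcousticSpace P).p = p := rfl
@[simp] theorem v_mk (p v : L2R) (y z : ell2Z) : (mk p v y z : AcousticSpace P).v = v := rfl
@[simp] theorem y_mk (p v : L2R) (y z : ell2Z) : (mk p v y z : AcousticSpace P).y = y := rfl
@[simp] theorem z_mk (p v : L2R) (y z : ell2Z) : (mk p v y z : AcousticSpace P).z = z := rfl
@[simp] theorem p_zero : (0 : AcousticSpace P).p = 0 := rfl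
@[simp] theorem v_zero : (0 : AcousticSpace P).v = 0 := rfl
@[simp] theorem y_zero : (0 : AcousticSpace P).y = 0 := rfl
@[simp] theorem z_zero : (0 : AcousticSpace P).z = 0 := rfl
@[simp] theorem p_add (Ψ Φ : AcousticSpace P) : (Ψ + Φ).p = Ψ.p + Φ.p := rfl
@[simp] theorem v_add (Ψ Φ : AcousticSpace P) : (Ψ + Φ).v = Ψ.v + Φ.v := rfl
@[simp] theorem y_add (Ψ Φ : AcousticSpace P) : (Ψ + Φ).y = Ψ.y + Φ.y := rfl
@[simp] theorem z_add (Ψ Φ : AcousticSpace P) : (Ψ + Φ).z = Ψ.z + Φ.z := rfl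
@[simp] theorem p_smul (c : ℂ) (Ψ : AcousticSpace P) : (c • Ψ).p = c • Ψ.p := rfl
@[simp] theorem v_smul (c : ℂ) (Ψ : AcousticSpace P) : (c • Ψ).v = c • Ψ.v := rfl
@[simp] theorem y_smul (c : ℂ) (Ψ : AcousticSpace P) : (c • Ψ).y = c • Ψ.y := rfl
@[simp] theorem z_smul (c : ℂ) (Ψ : AcousticSpace P) : (c • Ψ).z = c • Ψ.z := rfl

/-- The energy scalar product, conjugate linear in the first argument:
`(a²ρ₀)⁻¹⟨p₁,p₂⟩ + ρ₀⟨v₁,v₂⟩ + (K/S)⟨y₁,y₂⟩ + (M/S)⟨z₁,z₂⟩`. -/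
def energyInner (Ψ Φ : AcousticSpace P) : ℂ :=
  ((1 / (P.a ^ 2 * P.ρ₀) : ℝ) : ℂ) * inner ℂ Ψ.p Φ.p + ((P.ρ₀ : ℝ) : ℂ) * inner ℂ Ψ.v Φ.v
    + ((P.K / P.S : ℝ) : ℂ) * inner ℂ Ψ.y Φ.y + ((P.M / P.S : ℝ) : ℂ) * inner ℂ Ψ.z Φ.z

theorem re_energyInner_self (Ψ : AcousticSpace P) :
    (energyInner Ψ Ψ).re = 1 / (P.a ^ 2 * P.ρ₀) * ‖Ψ.p‖ ^ 2 + P.ρ₀ * ‖Ψ.v‖ ^ 2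
      + P.K / P.S * ‖Ψ.y‖ ^ 2 + P.M / P.S * ‖Ψ.z‖ ^ 2 := by
  simp only [energyInner, inner_self_eq_norm_sq_to_K, Complex.add_re, Complex.re_ofReal_mul]
  norm_cast

theorem coeff_pos (P : AcousticParams) :
    0 < 1 / (P.a ^ 2 * P.ρ₀) ∧ 0 < P.ρ₀ ∧ 0 < P.K / P.S ∧ 0 < P.M / P.S := by
  have := P.a_pos; have := P.ρ₀_pos; have := P.K_pos; have := P.M_pos; have := P.S_pos
  refine ⟨?_, ?_, ?_, ?_⟩ <;> positivity

/-- The energy scalar product is positive definite. -/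
@[reducible] def innerCore : InnerProductSpace.Core ℂ (AcousticSpace P) where
  inner := energyInner
  conj_inner_symm Ψ Φ := by
    simp [energyInner, inner_conj_symm]
  re_inner_nonneg Ψ := by
    change 0 ≤ (energyInner Ψ Ψ).re
    obtain ⟨h1, h2, h3, h4⟩ := coeff_pos P
    rw [re_energyInner_self]
    positivity
  add_left Ψ Φ Ξ := by
    simp only [energyInner, p_add, v_add, y_add, z_add, inner_add_left]
    ring
  smul_left Ψ Φ c := by
    simp only [energyInner, p_smul, v_smul, y_smul, z_smul, inner_smul_left]
    ring
  definite Ψ h := by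
    obtain ⟨h1, h2, h3, h4⟩ := coeff_pos P
    have h' : (energyInner Ψ Ψ).re = 0 := by
      have : energyInner Ψ Ψ = 0 := h
      rw [this]; rfl
    rw [re_energyInner_self] at h'
    have e1 : 0 ≤ 1 / (P.a ^ 2 * P.ρ₀) * ‖Ψ.p‖ ^ 2 := by positivity
    have e2 : 0 ≤ P.ρ₀ * ‖Ψ.v‖ ^ 2 := by positivity
    have e3 : 0 ≤ P.K / P.S * ‖Ψ.y‖ ^ 2 := by positivity
    have e4 : 0 ≤ P.M / P.S * ‖Ψ.z‖ ^ 2 := by positivity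
    have key : ∀ {c r : ℝ}, 0 < c → c * r ^ 2 = 0 → r = 0 := by
      intro c r hc hr
      rcases mul_eq_zero.1 hr with h | h
      · exact absurd h hc.ne'
      · exact pow_eq_zero_iff (two_ne_zero) |>.1 h
    apply AcousticSpace.ext
    · exact norm_eq_zero.1 (key h1 (by linarith))
    · exact norm_eq_zero.1 (key h2 (by linarith))
    · exact norm_eq_zero.1 (key h3 (by linarith))
    · exact norm_eq_zero.1 (key h4 (by linarith))

instance : NormedAddCommGroup (AcousticSpace P) :=
  @InnerProductSpace.Core.toNormedAddCommGroup ℂ (AcousticSpace P) _ _ _ innerCore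

instance : InnerProductSpace ℂ (AcousticSpace P) :=
  InnerProductSpace.ofCore (innerCore (P := P)).toCore

theorem inner_def (Ψ Φ : AcousticSpace P) : inner ℂ Ψ Φ = energyInner Ψ Φ := rfl

theorem norm_sq (Ψ : AcousticSpace P) :
    ‖Ψ‖ ^ 2 = 1 / (P.a ^ 2 * P.ρ₀) * ‖Ψ.p‖ ^ 2 + P.ρ₀ * ‖Ψ.v‖ ^ 2
      + P.K / P.S * ‖Ψ.y‖ ^ 2 + P.M / P.S * ‖Ψ.z‖ ^ 2 := by
  rw [← re_energyInner_self, ← inner_def]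
  exact norm_sq_eq_re_inner (𝕜 := ℂ) Ψ

/-- `AcousticSpace P` with its energy norm is isomorphic to the product with the sup norm. -/
def equivProd : AcousticSpace P ≃L[ℂ] (L2R × L2R × ell2Z × ell2Z) := by
  let e : AcousticSpace P ≃ₗ[ℂ] (L2R × L2R × ell2Z × ell2Z) :=
    LinearEquiv.refl ℂ (L2R × L2R × ell2Z × ell2Z)
  let c := 1 / (P.a ^ 2 * P.ρ₀) + P.ρ₀ + P.K / P.S + P.M / P.S
  let d := (1 / (P.a ^ 2 * P.ρ₀))⁻¹ + (P.ρ₀)⁻¹ + (P.K / P.S)⁻¹ + (P.M / P.S)⁻¹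
  refine e.toContinuousLinearEquivOfBounds (Real.sqrt d) (Real.sqrt c) ?_ ?_
  · intro Ψ
    obtain ⟨h1, h2, h3, h4⟩ := coeff_pos P
    have hn := norm_sq Ψ
    have key : ∀ {k r : ℝ}, 0 < k → k * r ^ 2 ≤ ‖Ψ‖ ^ 2 → k⁻¹ ≤ d → 0 ≤ r →
        r ≤ Real.sqrt d * ‖Ψ‖ := by
      intro k r hk h hd hr
      have hdk : 0 ≤ d := le_trans (by positivity) hd
      refine le_of_sq_le_sq ?_ (by positivity)
      rw [mul_pow, Real.sq_sqrt hdk]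
      calc r ^ 2 = k⁻¹ * (k * r ^ 2) := by field_simp
        _ ≤ d * ‖Ψ‖ ^ 2 := by gcongr
    have e1 : 0 ≤ 1 / (P.a ^ 2 * P.ρ₀) * ‖Ψ.p‖ ^ 2 := by positivity
    have e2 : 0 ≤ P.ρ₀ * ‖Ψ.v‖ ^ 2 := by positivity
    have e3 : 0 ≤ P.K / P.S * ‖Ψ.y‖ ^ 2 := by positivity
    have e4 : 0 ≤ P.M / P.S * ‖Ψ.z‖ ^ 2 := by positivity
    have i1 := inv_pos.2 h1
    have i2 := inv_pos.2 h2
    have i3 := inv_pos.2 h3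
    have i4 := inv_pos.2 h4
    have n1 : ‖Ψ.p‖ ≤ Real.sqrt d * ‖Ψ‖ :=
      key h1 (by linarith) (by simp only [d]; linarith) (norm_nonneg _)
    have n2 : ‖Ψ.v‖ ≤ Real.sqrt d * ‖Ψ‖ :=
      key h2 (by linarith) (by simp only [d]; linarith) (norm_nonneg _)
    have n3 : ‖Ψ.y‖ ≤ Real.sqrt d * ‖Ψ‖ :=
      key h3 (by linarith) (by simp only [d]; linarith) (norm_nonneg _)
    have n4 : ‖Ψ.z‖ ≤ Real.sqrt d * ‖Ψ‖ :=
      key h4 (by linarith) (by simp only [d]; linarith) (norm_nonneg _)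
    exact max_le n1 (max_le n2 (max_le n3 n4))
  · intro x
    obtain ⟨h1, h2, h3, h4⟩ := coeff_pos P
    have hn := norm_sq (P := P) (e.symm x)
    have hc : 0 ≤ c := by positivity
    have m1 : ‖(e.symm x).p‖ ≤ ‖x‖ := norm_fst_le x
    have m2 : ‖(e.symm x).v‖ ≤ ‖x‖ := (norm_fst_le x.2).trans (norm_snd_le x)
    have m3 : ‖(e.symm x).y‖ ≤ ‖x‖ :=
      (norm_fst_le x.2.2).trans ((norm_snd_le x.2).trans (norm_snd_le x))
    have m4 : ‖(e.symm x).z‖ ≤ ‖x‖ :=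
      (norm_snd_le x.2.2).trans ((norm_snd_le x.2).trans (norm_snd_le x))
    refine le_of_sq_le_sq ?_ (by positivity)
    rw [mul_pow, Real.sq_sqrt hc, hn]
    calc _ ≤ 1 / (P.a ^ 2 * P.ρ₀) * ‖x‖ ^ 2 + P.ρ₀ * ‖x‖ ^ 2
      + P.K / P.S * ‖x‖ ^ 2 + P.M / P.S * ‖x‖ ^ 2 := by gcongr
      _ = c * ‖x‖ ^ 2 := by simp only [c]; ring

instance : CompleteSpace (AcousticSpace P) :=
  (completeSpace_congr (e := (equivProd (P := P)).toEquiv)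
    (equivProd (P := P)).isUniformEmbedding).2 inferInstance

/-- Componentwise complex conjugation. -/
def conj (Ψ : AcousticSpace P) : AcousticSpace P := mk (star Ψ.p) (star Ψ.v) (star Ψ.y) (star Ψ.z)

/-- The vectors all of whose components are real. -/
def IsReal (Ψ : AcousticSpace P) : Prop :=
  (∀ᵐ x : ℝ, (Ψ.p x).im = 0) ∧ (∀ᵐ x : ℝ, (Ψ.v x).im = 0) ∧
    (∀ n : ℤ, (Ψ.y n).im = 0) ∧ (∀ n : ℤ, (Ψ.z n).im = 0)

end AcousticSpace

/-! ### Weak derivatives and Sobolev conditions on open subsets of the line -/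

/-- `g` is a weak (distributional) derivative of `f` on the open set `U`. -/
def HasWeakDeriv (U : Set ℝ) (f g : ℝ → ℂ) : Prop :=
  LocallyIntegrableOn f U ∧ LocallyIntegrableOn g U ∧
    ∀ φ : ℝ → ℝ, ContDiff ℝ ∞ φ → HasCompactSupport φ → tsupport φ ⊆ U →
      ∫ x, deriv φ x • f x = - ∫ x, φ x • g x

/-- `f ∈ H¹(U)`: `f` is square integrable on `U` with square integrable weak derivative on `U`. -/
def MemH1 (U : Set ℝ) (f : ℝ → ℂ) : Prop :=
  MemLp f 2 (volume.restrict U) ∧ ∃ g, MemLp g 2 (volume.restrict U) ∧ HasWeakDeriv U f g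

/-- The homogeneous Sobolev space of the line: `f` is locally square integrable
with square integrable weak derivative on `ℝ`. -/
def MemHomogeneousH1 (f : ℝ → ℂ) : Prop :=
  (∀ C : Set ℝ, IsCompact C → MemLp f 2 (volume.restrict C)) ∧
    ∃ g, MemLp g 2 volume ∧ HasWeakDeriv univ f g

theorem HasWeakDeriv.congr {U : Set ℝ} {f f' g g' : ℝ → ℂ} (h : HasWeakDeriv U f g)
    (hf : f' =ᵐ[volume] f) (hg : g' =ᵐ[volume] g) : HasWeakDeriv U f' g' := by
  refine ⟨(locallyIntegrableOn_congr (ae_restrict_of_ae hf)).2 h.1,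
    (locallyIntegrableOn_congr (ae_restrict_of_ae hg)).2 h.2.1, fun φ h1 h2 h3 => ?_⟩
  have e1 : ∫ x, deriv φ x • f' x = ∫ x, deriv φ x • f x := by
    apply integral_congr_ae; filter_upwards [hf] with x hx; rw [hx]
  have e2 : ∫ x, φ x • g' x = ∫ x, φ x • g x := by
    apply integral_congr_ae; filter_upwards [hg] with x hx; rw [hx]
  rw [e1, e2, h.2.2 φ h1 h2 h3]

theorem integrable_smul_of_tsupport_subset {U : Set ℝ} {f : ℝ → ℂ} (hf : LocallyIntegrableOn f U)
    {φ : ℝ → ℝ} (h1 : Continuous φ) (h2 : HasCompactSupport φ) (h3 : tsupport φ ⊆ U) :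
    Integrable (fun x => φ x • f x) := by
  have hi : IntegrableOn f (tsupport φ) := hf.integrableOn_compact_subset h3 h2
  have := hi.continuousOn_smul h1.continuousOn h2
  refine (integrableOn_iff_integrable_of_support_subset ?_).1 this
  exact (Function.support_smul_subset_left φ f).trans (subset_tsupport φ)

theorem HasWeakDeriv.add {U : Set ℝ} {f f' g g' : ℝ → ℂ} (h : HasWeakDeriv U f g)
    (h' : HasWeakDeriv U f' g') :
    HasWeakDeriv U (fun x => f x + f' x) (fun x => g x + g' x) := by
  refine ⟨h.1.add h'.1, h.2.1.add h'.2.1, fun φ h1 h2 h3 => ?_⟩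
  have c : Continuous (deriv φ) := h1.continuous_deriv (by simp)
  have s : tsupport (deriv φ) ⊆ U := tsupport_deriv_subset.trans h3
  simp only [smul_add]
  rw [integral_add (integrable_smul_of_tsupport_subset h.1 c h2.deriv s)
      (integrable_smul_of_tsupport_subset h'.1 c h2.deriv s),
    integral_add (integrable_smul_of_tsupport_subset h.2.1 h1.continuous h2 h3)
      (integrable_smul_of_tsupport_subset h'.2.1 h1.continuous h2 h3),
    h.2.2 φ h1 h2 h3, h'.2.2 φ h1 h2 h3]
  ring

theorem HasWeakDeriv.const_mul {U : Set ℝ} {f g : ℝ → ℂ} (h : HasWeakDeriv U f g) (c : ℂ) :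
    HasWeakDeriv U (fun x => c * f x) (fun x => c * g x) := by
  refine ⟨h.1.smul c, h.2.1.smul c, fun φ h1 h2 h3 => ?_⟩
  have e : ∀ (t : ℝ) (w : ℂ), t • (c * w) = c * (t • w) := fun t w => (mul_smul_comm t c w).symm
  simp only [e]
  rw [integral_const_mul, integral_const_mul, h.2.2 φ h1 h2 h3, mul_neg]

theorem HasWeakDeriv.zero (U : Set ℝ) : HasWeakDeriv U (fun _ => 0) (fun _ => 0) :=
  ⟨locallyIntegrableOn_zero, locallyIntegrableOn_zero, by simp⟩

/-- A weak derivative on `ℝ` of the zero function vanishes almost everywhere. -/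
theorem HasWeakDeriv.eq_zero {f g : ℝ → ℂ} (h : HasWeakDeriv univ f g) (hf : f =ᵐ[volume] 0) :
    g =ᵐ[volume] 0 := by
  apply ae_eq_zero_of_integral_contDiff_smul_eq_zero (locallyIntegrableOn_univ.1 h.2.1)
  intro φ h1 h2
  have h3 := h.2.2 φ h1 h2 (subset_univ _)
  have h4 : ∫ x, deriv φ x • f x = 0 := by
    rw [← integral_zero ℝ ℂ]
    apply integral_congr_ae; filter_upwards [hf] with x hx; simp [hx]
  rw [h4] at h3
  exact neg_eq_zero.1 h3.symm

theorem MemH1.congr {U : Set ℝ} {f f' : ℝ → ℂ} (h : MemH1 U f) (hf : f' =ᵐ[volume] f) :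
    MemH1 U f' := by
  obtain ⟨h1, g, h2, h3⟩ := h
  exact ⟨h1.ae_eq (ae_restrict_of_ae hf.symm), g, h2, h3.congr hf EventuallyEq.rfl⟩

theorem MemH1.add {U : Set ℝ} {f f' : ℝ → ℂ} (h : MemH1 U f) (h' : MemH1 U f') :
    MemH1 U (fun x => f x + f' x) := by
  obtain ⟨h1, g, h2, h3⟩ := h
  obtain ⟨h1', g', h2', h3'⟩ := h'
  exact ⟨h1.add h1', _, h2.add h2', h3.add h3'⟩

theorem MemH1.const_mul {U : Set ℝ} {f : ℝ → ℂ} (h : MemH1 U f) (c : ℂ) :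
    MemH1 U (fun x => c * f x) := by
  obtain ⟨h1, g, h2, h3⟩ := h
  exact ⟨h1.const_mul c, _, h2.const_mul c, h3.const_mul c⟩

theorem MemH1.zero (U : Set ℝ) : MemH1 U (fun _ => 0) :=
  ⟨MemLp.zero', _, MemLp.zero', HasWeakDeriv.zero U⟩

theorem MemHomogeneousH1.congr {f f' : ℝ → ℂ} (h : MemHomogeneousH1 f) (hf : f' =ᵐ[volume] f) :
    MemHomogeneousH1 f' := by
  obtain ⟨h1, g, h2, h3⟩ := h
  exact ⟨fun C hC => (h1 C hC).ae_eq (ae_restrict_of_ae hf.symm), g, h2,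
    h3.congr hf EventuallyEq.rfl⟩

theorem MemHomogeneousH1.add {f f' : ℝ → ℂ} (h : MemHomogeneousH1 f) (h' : MemHomogeneousH1 f') :
    MemHomogeneousH1 (fun x => f x + f' x) := by
  obtain ⟨h1, g, h2, h3⟩ := h
  obtain ⟨h1', g', h2', h3'⟩ := h'
  exact ⟨fun C hC => (h1 C hC).add (h1' C hC), _, h2.add h2', h3.add h3'⟩

theorem MemHomogeneousH1.const_mul {f : ℝ → ℂ} (h : MemHomogeneousH1 f) (c : ℂ) :
    MemHomogeneousH1 (fun x => c * f x) := by
  obtain ⟨h1, g, h2, h3⟩ := h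
  exact ⟨fun C hC => (h1 C hC).const_mul c, _, h2.const_mul c, h3.const_mul c⟩

theorem MemHomogeneousH1.zero : MemHomogeneousH1 (fun _ => 0) :=
  ⟨fun _ _ => MemLp.zero', _, MemLp.zero', HasWeakDeriv.zero univ⟩

/-! ### Lattice, jumps, point values, regular part -/

/-- The lattice `{nL : n ∈ ℤ}`. -/
def latticeSet (L : ℝ) : Set ℝ := range fun n : ℤ => (n : ℝ) * L

/-- `f(nL⁺) - f(nL⁻) = σ n` for all `n`, where `f(nL^±)` are the one-sided limits of
the representative of `f` that is continuous off the lattice. -/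
def HasJumps (L : ℝ) (f : ℝ → ℂ) (σ : ℤ → ℂ) : Prop :=
  ∃ u : ℝ → ℂ, u =ᵐ[volume] f ∧ ContinuousOn u (latticeSet L)ᶜ ∧
    ∀ n : ℤ, ∃ r l : ℂ, Tendsto u (𝓝[>] ((n : ℝ) * L)) (𝓝 r) ∧
      Tendsto u (𝓝[<] ((n : ℝ) * L)) (𝓝 l) ∧ r - l = σ n

/-- `f(nL) = ζ n` for all `n`, where `f(nL)` is the value of the continuous representative
of `f`. -/
def HasLatticeValues (L : ℝ) (f : ℝ → ℂ) (ζ : ℤ → ℂ) : Prop :=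
  ∃ u : ℝ → ℂ, u =ᵐ[volume] f ∧ Continuous u ∧ ∀ n : ℤ, u ((n : ℝ) * L) = ζ n

/-- The regular part of `f` with respect to the jumps `σ`:
`f(x) - ½ ∑ₙ σₙ (sgn(x - nL) - sgn(0 - nL))`.

For `σ ∈ ℓ²` the series `∑ₙ σₙ sgn(x - nL)` need not converge; with the `x`-independent
constants `sgn(0 - nL)` subtracted, only finitely many terms are nonzero at each `x`.
When the former series converges, the two versions of the regular part differ by a constant. -/
def regularPart (L : ℝ) (σ : ℤ → ℂ) (f : ℝ → ℂ) (x : ℝ) : ℂ :=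
  f x - 1 / 2 * ∑' n : ℤ, σ n *
    ((Real.sign (x - (n : ℝ) * L) - Real.sign (0 - (n : ℝ) * L) : ℝ) : ℂ)

/-- At each point only finitely many terms of the sum in `regularPart` are nonzero. -/
theorem summable_regularPart {L : ℝ} (hL : 0 < L) (σ : ℤ → ℂ) (x : ℝ) :
    Summable fun n : ℤ => σ n *
      ((Real.sign (x - (n : ℝ) * L) - Real.sign (0 - (n : ℝ) * L) : ℝ) : ℂ) := by
  apply summable_of_hasFiniteSupport
  refine (Set.finite_Icc (⌊-(|x| / L)⌋) (⌈|x| / L⌉)).subset fun n hn => ?_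
  by_contra hcon
  apply hn
  have hx := abs_le.1 (le_refl |x|)
  have hcase : |x| < (n : ℝ) * L ∨ (n : ℝ) * L < - |x| := by
    rw [Set.mem_Icc, not_and_or, not_le, not_le] at hcon
    rcases hcon with h | h
    · right
      have h' : (n : ℝ) < -(|x| / L) :=
        lt_of_lt_of_le (by exact_mod_cast h) (Int.floor_le (-(|x| / L)))
      have := mul_lt_mul_of_pos_right h' hL
      rwa [neg_mul, div_mul_cancel₀ _ hL.ne'] at this
    · left
      have h' : |x| / L < (n : ℝ) := (Int.le_ceil _).trans_lt (by exact_mod_cast h)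
      exact (div_lt_iff₀ hL).1 h'
  have := abs_nonneg x
  change σ n * ((Real.sign (x - (n : ℝ) * L) - Real.sign (0 - (n : ℝ) * L) : ℝ) : ℂ) = 0
  rcases hcase with h | h
  · rw [Real.sign_of_neg (by linarith : x - (n : ℝ) * L < 0),
      Real.sign_of_neg (by linarith : 0 - (n : ℝ) * L < 0)]; simp
  · rw [Real.sign_of_pos (by linarith : 0 < x - (n : ℝ) * L),
      Real.sign_of_pos (by linarith : 0 < 0 - (n : ℝ) * L)]; simp

theorem regularPart_add {L : ℝ} (hL : 0 < L) (σ σ' : ℤ → ℂ) (f f' : ℝ → ℂ) (x : ℝ) :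
    regularPart L (fun n => σ n + σ' n) (fun x => f x + f' x) x =
      regularPart L σ f x + regularPart L σ' f' x := by
  simp only [regularPart, add_mul]
  rw [(summable_regularPart hL σ x).tsum_add (summable_regularPart hL σ' x)]
  ring

theorem regularPart_const_mul (L : ℝ) (c : ℂ) (σ : ℤ → ℂ) (f : ℝ → ℂ) (x : ℝ) :
    regularPart L (fun n => c * σ n) (fun x => c * f x) x = c * regularPart L σ f x := by
  simp only [regularPart, mul_assoc]
  rw [tsum_mul_left]
  ring

theorem regularPart_congr {L : ℝ} {σ : ℤ → ℂ} {f f' : ℝ → ℂ} (h : f' =ᵐ[volume] f) :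
    regularPart L σ f' =ᵐ[volume] regularPart L σ f := by
  filter_upwards [h] with x hx
  simp only [regularPart, hx]

theorem HasJumps.congr {L : ℝ} {σ : ℤ → ℂ} {f f' : ℝ → ℂ} (h : HasJumps L f σ)
    (hf : f' =ᵐ[volume] f) : HasJumps L f' σ := by
  obtain ⟨u, h1, h2⟩ := h
  exact ⟨u, h1.trans hf.symm, h2⟩

theorem HasJumps.add {L : ℝ} {σ σ' : ℤ → ℂ} {f f' : ℝ → ℂ} (h : HasJumps L f σ)
    (h' : HasJumps L f' σ') : HasJumps L (fun x => f x + f' x) (fun n => σ n + σ' n) := by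
  obtain ⟨u, h1, h2, h3⟩ := h
  obtain ⟨u', h1', h2', h3'⟩ := h'
  refine ⟨fun x => u x + u' x, h1.add h1', h2.add h2', fun n => ?_⟩
  obtain ⟨r, l, a, b, c⟩ := h3 n
  obtain ⟨r', l', a', b', c'⟩ := h3' n
  exact ⟨r + r', l + l', a.add a', b.add b', by simp only [← c, ← c']; ring⟩

theorem HasJumps.const_mul {L : ℝ} {σ : ℤ → ℂ} {f : ℝ → ℂ} (h : HasJumps L f σ) (k : ℂ) :
    HasJumps L (fun x => k * f x) (fun n => k * σ n) := by
  obtain ⟨u, h1, h2, h3⟩ := h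
  refine ⟨fun x => k * u x, ?_, h2.const_smul k, fun n => ?_⟩
  · filter_upwards [h1] with x hx; rw [hx]
  obtain ⟨r, l, a, b, c⟩ := h3 n
  exact ⟨k * r, k * l, a.const_mul k, b.const_mul k, by simp only [← c]; ring⟩

theorem HasJumps.zero (L : ℝ) : HasJumps L (fun _ => 0) (fun _ => 0) :=
  ⟨fun _ => 0, EventuallyEq.rfl, continuousOn_const,
    fun _ => ⟨0, 0, tendsto_const_nhds, tendsto_const_nhds, sub_zero 0⟩⟩

theorem isClosed_latticeSet {L : ℝ} (hL : 0 < L) : IsClosed (latticeSet L) := by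
  have : latticeSet L = (fun x : ℝ => x / L) ⁻¹' (range ((↑) : ℤ → ℝ)) := by
    ext x
    simp only [latticeSet, mem_range, mem_preimage, eq_div_iff hL.ne']
  rw [this]
  exact Int.isClosedEmbedding_coe_real.isClosed_range.preimage (by fun_prop)

theorem lattice_compl_mem_right {L : ℝ} (hL : 0 < L) (n : ℤ) :
    (latticeSet L)ᶜ ∈ 𝓝[>] ((n : ℝ) * L) := by
  have h1 : Ioo ((n : ℝ) * L) ((n : ℝ) * L + L) ∈ 𝓝[>] ((n : ℝ) * L) :=
    Ioo_mem_nhdsGT (by linarith)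
  filter_upwards [h1] with x hx
  rintro ⟨m, rfl⟩
  have h2 : (n : ℝ) < m := lt_of_mul_lt_mul_right hx.1 hL.le
  have h3 : (m : ℝ) < n + 1 := by
    refine lt_of_mul_lt_mul_right (a := L) ?_ hL.le
    have := hx.2
    simp only at this
    linarith
  have h4 : n < m := by exact_mod_cast h2
  have h5 : m < n + 1 := by exact_mod_cast h3
  omega

theorem lattice_compl_mem_left {L : ℝ} (hL : 0 < L) (n : ℤ) :
    (latticeSet L)ᶜ ∈ 𝓝[<] ((n : ℝ) * L) := by
  have h1 : Ioo ((n : ℝ) * L - L) ((n : ℝ) * L) ∈ 𝓝[<] ((n : ℝ) * L) :=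
    Ioo_mem_nhdsLT (by linarith)
  filter_upwards [h1] with x hx
  rintro ⟨m, rfl⟩
  have h2 : (m : ℝ) < n := lt_of_mul_lt_mul_right hx.2 hL.le
  have h3 : (n : ℝ) - 1 < m := by
    refine lt_of_mul_lt_mul_right (a := L) ?_ hL.le
    have := hx.1
    simp only at this
    linarith
  have h4 : m < n := by exact_mod_cast h2
  have h5 : n - 1 < m := by exact_mod_cast h3
  omega

/-- The zero function has zero jumps only. -/
theorem HasJumps.eq_zero {L : ℝ} (hL : 0 < L) {σ : ℤ → ℂ} {f : ℝ → ℂ} (h : HasJumps L f σ)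
    (hf : f =ᵐ[volume] 0) (n : ℤ) : σ n = 0 := by
  obtain ⟨u, h1, h2, h3⟩ := h
  have hu : EqOn u 0 (latticeSet L)ᶜ :=
    Measure.eqOn_open_of_ae_eq (ae_restrict_of_ae (h1.trans hf))
      (isClosed_latticeSet hL).isOpen_compl h2 continuousOn_const
  obtain ⟨r, l, a, b, c⟩ := h3 n
  have hr : r = 0 := by
    refine tendsto_nhds_unique a (Tendsto.congr' ?_ tendsto_const_nhds)
    filter_upwards [lattice_compl_mem_right hL n] with x hx using (hu hx).symm
  have hl : l = 0 := by
    refine tendsto_nhds_unique b (Tendsto.congr' ?_ tendsto_const_nhds)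
    filter_upwards [lattice_compl_mem_left hL n] with x hx using (hu hx).symm
  rw [← c, hr, hl, sub_zero]

theorem HasLatticeValues.congr {L : ℝ} {σ : ℤ → ℂ} {f f' : ℝ → ℂ} (h : HasLatticeValues L f σ)
    (hf : f' =ᵐ[volume] f) : HasLatticeValues L f' σ := by
  obtain ⟨u, h1, h2⟩ := h
  exact ⟨u, h1.trans hf.symm, h2⟩

theorem HasLatticeValues.add {L : ℝ} {σ σ' : ℤ → ℂ} {f f' : ℝ → ℂ} (h : HasLatticeValues L f σ)
    (h' : HasLatticeValues L f' σ') :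
    HasLatticeValues L (fun x => f x + f' x) (fun n => σ n + σ' n) := by
  obtain ⟨u, h1, h2, h3⟩ := h
  obtain ⟨u', h1', h2', h3'⟩ := h'
  exact ⟨fun x => u x + u' x, h1.add h1', h2.add h2', fun n => by simp only [h3, h3']⟩

theorem HasLatticeValues.const_mul {L : ℝ} {σ : ℤ → ℂ} {f : ℝ → ℂ} (h : HasLatticeValues L f σ)
    (k : ℂ) : HasLatticeValues L (fun x => k * f x) (fun n => k * σ n) := by
  obtain ⟨u, h1, h2, h3⟩ := h
  refine ⟨fun x => k * u x, ?_, h2.const_smul k, fun n => by simp only [h3]⟩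
  filter_upwards [h1] with x hx; rw [hx]

theorem HasLatticeValues.zero (L : ℝ) : HasLatticeValues L (fun _ => 0) (fun _ => 0) :=
  ⟨fun _ => 0, EventuallyEq.rfl, continuous_const, fun _ => rfl⟩

/-! ### The operator -/

variable {P : AcousticParams}

/-- The conditions defining the domain: `Ψ = (p, v, y, z)` with `p ∈ L²(ℝ) ∩ H¹(ℝ ∖ Lℤ)`,
`v ∈ H¹(ℝ)`, jumps `p(nL⁺) - p(nL⁻) = σₙ` and `v(nL) = zₙ`, for the given `σ ∈ ℓ²`. -/
structure DomainConditions (Ψ : AcousticSpace P) (σ : ell2Z) : Prop where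
  p_mem : MemH1 (latticeSet P.L)ᶜ Ψ.p
  v_mem : MemH1 univ Ψ.v
  jumps : HasJumps P.L Ψ.p σ
  values : HasLatticeValues P.L Ψ.v Ψ.z

/-- `Φ = (-a²ρ₀ dv/dx, -ρ₀⁻¹ dp₀/dx, z, -(K/M) y - (S/M) σ)` for `Ψ = (p, v, y, z)`, where `p₀`,
the regular part of `p`, lies in the homogeneous Sobolev space and the derivatives are weak
derivatives on the whole line. -/
structure ActionFormula (Ψ Φ : AcousticSpace P) (σ : ell2Z) : Prop where
  p_eq : ∃ dv : ℝ → ℂ, HasWeakDeriv univ Ψ.v dv ∧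
    Φ.p =ᵐ[volume] fun x => -((P.a ^ 2 * P.ρ₀ : ℝ) : ℂ) * dv x
  p₀_mem : MemHomogeneousH1 (regularPart P.L σ Ψ.p)
  v_eq : ∃ dp₀ : ℝ → ℂ, HasWeakDeriv univ (regularPart P.L σ Ψ.p) dp₀ ∧
    Φ.v =ᵐ[volume] fun x => -((1 / P.ρ₀ : ℝ) : ℂ) * dp₀ x
  y_eq : Φ.y = Ψ.z
  z_eq : Φ.z = -(((P.K / P.M : ℝ) : ℂ) • Ψ.y) - ((P.S / P.M : ℝ) : ℂ) • σ

theorem DomainConditions.add {Ψ Ψ' : AcousticSpace P} {σ σ' : ell2Z} (h : DomainConditions Ψ σ)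
    (h' : DomainConditions Ψ' σ') : DomainConditions (Ψ + Ψ') (σ + σ') where
  p_mem := (h.p_mem.add h'.p_mem).congr (Lp.coeFn_add _ _)
  v_mem := (h.v_mem.add h'.v_mem).congr (Lp.coeFn_add _ _)
  jumps := (h.jumps.add h'.jumps).congr (Lp.coeFn_add _ _)
  values := (h.values.add h'.values).congr (Lp.coeFn_add _ _)

theorem DomainConditions.smul {Ψ : AcousticSpace P} {σ : ell2Z} (h : DomainConditions Ψ σ)
    (c : ℂ) : DomainConditions (c • Ψ) (c • σ) where
  p_mem := (h.p_mem.const_mul c).congr (Lp.coeFn_smul _ _)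
  v_mem := (h.v_mem.const_mul c).congr (Lp.coeFn_smul _ _)
  jumps := (h.jumps.const_mul c).congr (Lp.coeFn_smul _ _)
  values := (h.values.const_mul c).congr (Lp.coeFn_smul _ _)

theorem DomainConditions.zero : DomainConditions (0 : AcousticSpace P) 0 where
  p_mem := (MemH1.zero _).congr (Lp.coeFn_zero _ _ _)
  v_mem := (MemH1.zero _).congr (Lp.coeFn_zero _ _ _)
  jumps := (HasJumps.zero _).congr (Lp.coeFn_zero _ _ _)
  values := (HasLatticeValues.zero _).congr (Lp.coeFn_zero _ _ _)

theorem regularPart_Lp_add (f f' : L2R) (σ σ' : ell2Z) :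
    regularPart P.L ↑(σ + σ') ↑(f + f') =ᵐ[volume]
      fun x => regularPart P.L σ f x + regularPart P.L σ' f' x :=
  (regularPart_congr (Lp.coeFn_add _ _)).trans
    (Eventually.of_forall fun x => regularPart_add P.L_pos _ _ _ _ x)

theorem regularPart_Lp_smul (c : ℂ) (f : L2R) (σ : ell2Z) :
    regularPart P.L ↑(c • σ) ↑(c • f) =ᵐ[volume] fun x => c * regularPart P.L σ f x :=
  (regularPart_congr (Lp.coeFn_smul _ _)).trans
    (Eventually.of_forall fun x => regularPart_const_mul _ _ _ _ x)

theorem regularPart_zero (L : ℝ) {σ : ℤ → ℂ} (hσ : ∀ n, σ n = 0) {f : ℝ → ℂ}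
    (hf : f =ᵐ[volume] 0) : regularPart L σ f =ᵐ[volume] fun _ => 0 := by
  filter_upwards [hf] with x hx
  simp [regularPart, hσ, hx]

theorem ActionFormula.add {Ψ Ψ' Φ Φ' : AcousticSpace P} {σ σ' : ell2Z} (h : ActionFormula Ψ Φ σ)
    (h' : ActionFormula Ψ' Φ' σ') : ActionFormula (Ψ + Ψ') (Φ + Φ') (σ + σ') where
  p_eq := by
    obtain ⟨g, h1, h2⟩ := h.p_eq
    obtain ⟨g', h1', h2'⟩ := h'.p_eq
    refine ⟨_, (h1.add h1').congr (Lp.coeFn_add _ _) EventuallyEq.rfl, ?_⟩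
    filter_upwards [Lp.coeFn_add Φ.p Φ'.p, h2, h2'] with x e1 e2 e3
    rw [AcousticSpace.p_add, e1, Pi.add_apply, e2, e3, mul_add]
  p₀_mem := (h.p₀_mem.add h'.p₀_mem).congr (regularPart_Lp_add _ _ _ _)
  v_eq := by
    obtain ⟨g, h1, h2⟩ := h.v_eq
    obtain ⟨g', h1', h2'⟩ := h'.v_eq
    refine ⟨_, (h1.add h1').congr (regularPart_Lp_add _ _ _ _) EventuallyEq.rfl, ?_⟩
    filter_upwards [Lp.coeFn_add Φ.v Φ'.v, h2, h2'] with x e1 e2 e3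
    rw [AcousticSpace.v_add, e1, Pi.add_apply, e2, e3, mul_add]
  y_eq := by simp [h.y_eq, h'.y_eq]
  z_eq := by
    simp only [AcousticSpace.z_add, AcousticSpace.y_add, h.z_eq, h'.z_eq, smul_add]
    abel

theorem ActionFormula.smul {Ψ Φ : AcousticSpace P} {σ : ell2Z} (h : ActionFormula Ψ Φ σ) (c : ℂ) :
    ActionFormula (c • Ψ) (c • Φ) (c • σ) where
  p_eq := by
    obtain ⟨g, h1, h2⟩ := h.p_eq
    refine ⟨_, (h1.const_mul c).congr (Lp.coeFn_smul _ _) EventuallyEq.rfl, ?_⟩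
    filter_upwards [Lp.coeFn_smul c Φ.p, h2] with x e1 e2
    rw [AcousticSpace.p_smul, e1, Pi.smul_apply, e2, smul_eq_mul]; ring
  p₀_mem := (h.p₀_mem.const_mul c).congr (regularPart_Lp_smul _ _ _)
  v_eq := by
    obtain ⟨g, h1, h2⟩ := h.v_eq
    refine ⟨_, (h1.const_mul c).congr (regularPart_Lp_smul _ _ _) EventuallyEq.rfl, ?_⟩
    filter_upwards [Lp.coeFn_smul c Φ.v, h2] with x e1 e2
    rw [AcousticSpace.v_smul, e1, Pi.smul_apply, e2, smul_eq_mul]; ring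
  y_eq := by simp [h.y_eq]
  z_eq := by
    simp only [AcousticSpace.z_smul, AcousticSpace.y_smul, h.z_eq, smul_sub, smul_neg]
    rw [smul_comm c, smul_comm c (((P.S / P.M : ℝ) : ℂ))]

theorem ActionFormula.zero : ActionFormula (0 : AcousticSpace P) 0 0 where
  p_eq := ⟨_, (HasWeakDeriv.zero univ).congr (Lp.coeFn_zero _ _ _) EventuallyEq.rfl, Eventually.of_forall fun x => by simp⟩
  p₀_mem := MemHomogeneousH1.zero.congr
    (regularPart_zero _ (fun _ => rfl) (Lp.coeFn_zero _ _ _))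
  v_eq := ⟨_, (HasWeakDeriv.zero univ).congr
    (regularPart_zero _ (fun _ => rfl) (Lp.coeFn_zero _ _ _)) EventuallyEq.rfl, Eventually.of_forall fun x => by simp⟩
  y_eq := by simp
  z_eq := by simp

/-- The graph of the operator: all pairs `(Ψ, Φ)` such that `Ψ` satisfies the domain
conditions and `Φ` is given by the action formula, for a common `σ ∈ ℓ²`. -/
def acousticGraph (P : AcousticParams) : Submodule ℂ (AcousticSpace P × AcousticSpace P) where
  carrier := {x | ∃ σ : ell2Z, DomainConditions x.1 σ ∧ ActionFormula x.1 x.2 σ}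
  add_mem' := by
    rintro x x' ⟨σ, h1, h2⟩ ⟨σ', h1', h2'⟩
    exact ⟨σ + σ', h1.add h1', h2.add h2'⟩
  zero_mem' := ⟨0, DomainConditions.zero, ActionFormula.zero⟩
  smul_mem' := by
    rintro c x ⟨σ, h1, h2⟩
    exact ⟨c • σ, h1.smul c, h2.smul c⟩

/-- The graph is single valued. -/
theorem acousticGraph_single_valued (P : AcousticParams) :
    ∀ x ∈ acousticGraph P, x.1 = 0 → x.2 = 0 := by
  rintro ⟨Ψ, Φ⟩ ⟨σ, h1, h2⟩ h
  dsimp only at h h1 h2 ⊢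
  subst h
  have hz : ((0 : L2R) : ℝ → ℂ) =ᵐ[volume] 0 := Lp.coeFn_zero _ _ _
  have hσ : ∀ n, σ n = 0 := h1.jumps.eq_zero P.L_pos hz
  have hσ' : σ = 0 := by
    apply lp.ext; funext n; exact hσ n
  apply AcousticSpace.ext
  · obtain ⟨g, e1, e2⟩ := h2.p_eq
    apply Lp.ext
    filter_upwards [e2, e1.eq_zero hz, hz] with x i1 i2 i3
    rw [i1, i2, AcousticSpace.p_zero, i3]; simp
  · obtain ⟨g, e1, e2⟩ := h2.v_eq
    apply Lp.ext
    filter_upwards [e2, e1.eq_zero (regularPart_zero _ hσ hz), hz] with x i1 i2 i3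
    rw [i1, i2, AcousticSpace.v_zero, i3]; simp
  · simp [h2.y_eq]
  · simp [h2.z_eq, hσ']

/-- The (unbounded) generator `Â` of the dynamics of the acoustic field coupled to the periodic
array of oscillators. -/
def acousticOperator (P : AcousticParams) : AcousticSpace P →ₗ.[ℂ] AcousticSpace P :=
  (acousticGraph P).toLinearPMap

theorem mem_graph_acousticOperator {Ψ Φ : AcousticSpace P} :
    (Ψ, Φ) ∈ (acousticOperator P).graph ↔
      ∃ σ : ell2Z, DomainConditions Ψ σ ∧ ActionFormula Ψ Φ σ := by
  rw [acousticOperator, Submodule.toLinearPMap_graph_eq _ (acousticGraph_single_valued P)]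
  rfl

/-! ### Properties of unbounded operators -/

/-- A densely defined operator is skew-adjoint if its adjoint (with equal domains) is `-A`. -/
def IsSkewAdjointOp {E : Type*} [NormedAddCommGroup E] [InnerProductSpace ℂ E] [CompleteSpace E]
    (A : E →ₗ.[ℂ] E) : Prop :=
  Dense (A.domain : Set E) ∧ A.adjoint = -A

/-- An operator is real if its domain is invariant under complex conjugation and it maps real
elements of its domain to real elements. -/
def IsRealOp (A : AcousticSpace P →ₗ.[ℂ] AcousticSpace P) : Prop :=
  (∀ Ψ ∈ A.domain, Ψ.conj ∈ A.domain) ∧ ∀ Ψ : A.domain, (Ψ : AcousticSpace P).IsReal → (A Ψ).IsReal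

end

/-! ### Primitives of locally integrable functions -/

/-! In one dimension a function with a weak derivative on an interval is, up to a null set, a
primitive of it (du Bois-Reymond). Hence a pair (Ψ, Φ) in the graph can be described without
distributions: v has a representative V that is a primitive of a multiple of Φ.p, and p equals G
plus a constant c_n on the n-th cell of the lattice, with G a primitive of a multiple of Φ.v and σ_n
= c_n - c_{n-1}. The sign sum in the regular part removes exactly the step function c, up to a
constant. This is `GraphData` with `mem_graph_iff`; reality follows because all coefficients are
real and conjugation acts on these data.

Skew-symmetry is integration by parts cell by cell (`hasSum_green`): the boundary terms combine to
the sum of conj(V(nL)) σ'_n, which is ⟨z, σ'⟩. With the weight M/S this is what the term -(S/M)σ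
cancels, and the spring terms cancel because (M/S)(K/M) = K/S.

For the converse inclusion, let ⟨W, Ψ⟩ = ⟨X, Φ⟩ for all (Ψ, Φ) in the graph. Displacements, smooth
pressures, pressures with one unit jump, velocities supported off the lattice, and velocity bumps at
one lattice point yield in turn W.y = -X.z, the derivative of X.v, its lattice values, the
derivative of X.p off the lattice, and the jumps of X.p. The jumps come out as a combination of W.z
and X.y, hence lie in ℓ², and (X, -W) is in the graph (`mem_graph_of_inner_eq`). Most of the same
families show that the domain is dense. -/

/-- `F` is a primitive of the locally integrable function `f`. -/
structure IsPrimitive (F f : ℝ → ℂ) : Prop where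
  locallyIntegrable : LocallyIntegrable f
  integral_eq : ∀ x y, ∫ t in x..y, f t = F y - F x

theorem MeasureTheory.LocallyIntegrable.intervalIntegrable_real {f : ℝ → ℂ}
    (hf : LocallyIntegrable f) (a b : ℝ) : IntervalIntegrable f volume a b :=
  intervalIntegrable_iff.mpr
    ((hf.integrableOn_isCompact isCompact_uIcc).mono_set uIoc_subset_uIcc)

theorem isPrimitive_integral {f : ℝ → ℂ} (hf : LocallyIntegrable f) (a : ℝ) :
    IsPrimitive (fun x => ∫ t in a..x, f t) f where
  locallyIntegrable := hf
  integral_eq x y := (intervalIntegral.integral_interval_sub_left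
    (hf.intervalIntegrable_real a y) (hf.intervalIntegrable_real a x)).symm

namespace IsPrimitive

variable {F f G g : ℝ → ℂ}

theorem of_base (hf : LocallyIntegrable f) (a : ℝ) (h : ∀ y, ∫ t in a..y, f t = F y - F a) :
    IsPrimitive F f where
  locallyIntegrable := hf
  integral_eq x y := by
    rw [← intervalIntegral.integral_interval_sub_left (hf.intervalIntegrable_real a y)
      (hf.intervalIntegrable_real a x), h, h]
    ring

theorem eq_add (h : IsPrimitive F f) (a x : ℝ) : F x = F a + ∫ t in a..x, f t := by
  rw [h.integral_eq]; ring

theorem continuous (h : IsPrimitive F f) : Continuous F := by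
  have : F = fun x => F 0 + ∫ t in (0 : ℝ)..x, f t := funext fun x => h.eq_add 0 x
  rw [this]
  exact continuous_const.add
    (intervalIntegral.continuous_primitive (h.locallyIntegrable.intervalIntegrable_real) 0)

theorem congr (h : IsPrimitive F f) (hg : g =ᵐ[volume] f) : IsPrimitive F g where
  locallyIntegrable := h.locallyIntegrable.congr hg.symm
  integral_eq x y := by
    rw [← h.integral_eq]
    exact intervalIntegral.integral_congr_ae (hg.mono fun x hx _ => hx)

theorem add_const (h : IsPrimitive F f) (c : ℂ) : IsPrimitive (fun x => F x + c) f where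
  locallyIntegrable := h.locallyIntegrable
  integral_eq x y := by rw [h.integral_eq]; ring

theorem zero : IsPrimitive (fun _ => 0) (fun _ => 0) where
  locallyIntegrable := locallyIntegrable_zero
  integral_eq x y := by simp

theorem star (h : IsPrimitive F f) :
    IsPrimitive (fun x => starRingEnd ℂ (F x)) (fun x => starRingEnd ℂ (f x)) where
  locallyIntegrable x := by
    obtain ⟨s, hs, hi⟩ := h.locallyIntegrable x
    exact ⟨s, hs, (Complex.conjCLE : ℂ →L[ℝ] ℂ).integrable_comp hi⟩
  integral_eq x y := by
    have := (Complex.conjCLE : ℂ →L[ℝ] ℂ).intervalIntegral_comp_comm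
      (h.locallyIntegrable.intervalIntegrable_real x y)
    rw [← map_sub, ← h.integral_eq]
    exact this

/-- The increments of `F` are dominated by those of the integral of the norm of `f`, which is
absolutely continuous. -/
theorem absolutelyContinuousOnInterval (h : IsPrimitive F f) (a b : ℝ) :
    AbsolutelyContinuousOnInterval F a b := by
  have hn := (h.locallyIntegrable.intervalIntegrable_real a b).norm
  have hN := hn.absolutelyContinuousOnInterval_intervalIntegral (c := a) (by simp)
  refine squeeze_zero (fun t => Finset.sum_nonneg fun i _ => dist_nonneg)
    (fun t => Finset.sum_le_sum fun i _ => ?_) hN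
  have hi := fun x y => (h.locallyIntegrable.intervalIntegrable_real x y).norm
  rw [dist_comm, dist_eq_norm, ← h.integral_eq, dist_comm, Real.dist_eq,
    intervalIntegral.integral_interval_sub_left (hi _ _) (hi _ _)]
  exact intervalIntegral.norm_integral_le_abs_integral_norm

theorem ae_hasDerivAt (h : IsPrimitive F f) : ∀ᵐ x, HasDerivAt F (f x) x := by
  have : F = fun x => F 0 + ∫ t in (0 : ℝ)..x, f t := funext fun x => h.eq_add 0 x
  filter_upwards [_root_.LocallyIntegrable.ae_hasDerivAt_integral h.locallyIntegrable] with x hx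
  rw [this]
  exact (hx 0).const_add _

/-- The product minus the integral of the expected derivative is absolutely continuous with
derivative zero almost everywhere, hence constant. No smoothness of either factor is needed. -/
theorem mul (hF : IsPrimitive F f) (hG : IsPrimitive G g) :
    IsPrimitive (fun x => F x * G x) (fun x => f x * G x + F x * g x) := by
  have hl : LocallyIntegrable (fun x => f x * G x + F x * g x) :=
    (hF.locallyIntegrable.mul_continuous hG.continuous).add
      (by simpa only [mul_comm] using hG.locallyIntegrable.mul_continuous hF.continuous)
  refine ⟨hl, fun x y => ?_⟩
  have hH := isPrimitive_integral hl x
  have hac : AbsolutelyContinuousOnInterval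
      (fun s => F s • G s - ∫ t in x..s, (f t * G t + F t * g t)) x y :=
    ((hF.absolutelyContinuousOnInterval x y).fun_smul
      (hG.absolutelyContinuousOnInterval x y)).fun_sub (hH.absolutelyContinuousOnInterval x y)
  obtain ⟨C, hC⟩ := hac.const_of_ae_hasDerivAt_zero (by
    filter_upwards [hF.ae_hasDerivAt, hG.ae_hasDerivAt, hH.ae_hasDerivAt] with s h1 h2 h3 _
    simpa using (h1.fun_mul h2).fun_sub h3)
  have e1 := hC x left_mem_uIcc
  have e2 := hC y right_mem_uIcc
  simp only [smul_eq_mul, intervalIntegral.integral_same, sub_zero] at e1 e2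
  rw [e1, ← e2]
  ring

theorem of_contDiff {φ : ℝ → ℝ} (h : ContDiff ℝ ∞ φ) :
    IsPrimitive (fun x => (φ x : ℂ)) (fun x => ((deriv φ x : ℝ) : ℂ)) := by
  have hc : Continuous (deriv φ) := h.continuous_deriv (by simp)
  refine ⟨(Complex.continuous_ofReal.comp hc).locallyIntegrable, fun x y => ?_⟩
  rw [intervalIntegral.integral_ofReal, intervalIntegral.integral_deriv_eq_sub
    (fun t _ => (h.differentiable (by simp)).differentiableAt) (hc.intervalIntegrable _ _)]
  simp

/-- Product rule for φF on an interval containing the support of φ, where the boundary terms vanish.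
-/
theorem hasWeakDeriv (h : IsPrimitive F f) (U : Set ℝ) : HasWeakDeriv U F f := by
  refine ⟨h.continuous.locallyIntegrable.locallyIntegrableOn U,
    h.locallyIntegrable.locallyIntegrableOn U, fun φ h1 h2 _ => ?_⟩
  have hc : Continuous (deriv φ) := h1.continuous_deriv (by simp)
  have hp := (of_contDiff h1).mul h
  have hzero : ∫ x, (((deriv φ x : ℝ) : ℂ) * F x + (φ x : ℂ) * f x) = 0 := by
    obtain ⟨R, hR⟩ := h2.isBounded.subset_ball 0
    have hz : ∀ x, R ≤ |x| → φ x = 0 := fun x hx => by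
      by_contra hne
      have := hR (subset_tsupport φ hne)
      rw [mem_ball_zero_iff, Real.norm_eq_abs] at this
      linarith
    -- The absolute value covers a negative `R`, possible when the support is empty.
    have hs : Function.support (fun x => ((deriv φ x : ℝ) : ℂ) * F x + (φ x : ℂ) * f x)
        ⊆ Ioc (-|R|) |R| := fun x hx => by
      have hm : x ∈ tsupport φ := by
        by_contra hn
        apply hx
        have e1 : φ x = 0 := image_eq_zero_of_notMem_tsupport hn
        have e2 : deriv φ x = 0 :=
          image_eq_zero_of_notMem_tsupport fun hd => hn (tsupport_deriv_subset hd)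
        simp [e1, e2]
      have := hR hm
      rw [mem_ball_zero_iff, Real.norm_eq_abs] at this
      have h2 := abs_lt.1 (this.trans_le (le_abs_self R))
      exact ⟨h2.1, h2.2.le⟩
    rw [← intervalIntegral.integral_eq_integral_of_support_subset hs, hp.integral_eq,
      hz _ (by simp [le_abs_self]), hz _ (by simp [le_abs_self])]
    simp
  have i1 := integrable_smul_of_tsupport_subset (h.continuous.locallyIntegrable.locallyIntegrableOn
    univ) hc h2.deriv (subset_univ _)
  have i2 := integrable_smul_of_tsupport_subset (h.locallyIntegrable.locallyIntegrableOn
    univ) h1.continuous h2 (subset_univ _)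
  rw [eq_neg_iff_add_eq_zero, ← integral_add i1 i2]
  simpa [Complex.real_smul] using hzero

end IsPrimitive

/-! ### Weak derivatives -/

theorem HasWeakDeriv.mono {U V : Set ℝ} {f g : ℝ → ℂ} (h : HasWeakDeriv U f g) (hV : V ⊆ U) :
    HasWeakDeriv V f g :=
  ⟨h.1.mono_set hV, h.2.1.mono_set hV, fun φ h1 h2 h3 => h.2.2 φ h1 h2 (h3.trans hV)⟩

theorem HasWeakDeriv.sub {U : Set ℝ} {f f' g g' : ℝ → ℂ} (h : HasWeakDeriv U f g)
    (h' : HasWeakDeriv U f' g') :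
    HasWeakDeriv U (fun x => f x - f' x) (fun x => g x - g' x) := by
  have := h.add (h'.const_mul (-1))
  simpa only [neg_one_mul, ← sub_eq_add_neg] using this

/-- A weak derivative on an open set is unique. -/
theorem HasWeakDeriv.unique {U : Set ℝ} (hU : IsOpen U) {f g g' : ℝ → ℂ} (h : HasWeakDeriv U f g)
    (h' : HasWeakDeriv U f g') : ∀ᵐ x, x ∈ U → g x = g' x := by
  have hs := h.sub h'
  have := hU.ae_eq_zero_of_integral_contDiff_smul_eq_zero hs.2.1 fun φ h1 h2 h3 => by
    have := hs.2.2 φ h1 h2 h3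
    simpa using this.symm
  filter_upwards [this] with x hx hxU using sub_eq_zero.1 (hx hxU)

theorem contDiff_integral {χ : ℝ → ℝ} (h : ContDiff ℝ ∞ χ) (a : ℝ) :
    ContDiff ℝ ∞ (fun x => ∫ t in a..x, χ t) ∧ deriv (fun x => ∫ t in a..x, χ t) = χ := by
  have hd : ∀ x, HasDerivAt (fun x => ∫ t in a..x, χ t) (χ x) x := fun x =>
    h.continuous.integral_hasStrictDerivAt a x |>.hasDerivAt
  have he : deriv (fun x => ∫ t in a..x, χ t) = χ := funext fun x => (hd x).deriv
  refine ⟨contDiff_infty_iff_deriv.2 ⟨fun x => (hd x).differentiableAt, ?_⟩, he⟩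
  rw [he]; exact h

/-- The lemma of du Bois-Reymond: a function with vanishing weak derivative on an open interval is
almost everywhere constant there. -/
theorem HasWeakDeriv.ae_const {U : Set ℝ} (hU : IsOpen U) (hc : U.OrdConnected) {f : ℝ → ℂ}
    (h : HasWeakDeriv U f (fun _ => 0)) : ∃ C : ℂ, ∀ᵐ x, x ∈ U → f x = C := by
  rcases U.eq_empty_or_nonempty with rfl | ⟨x₀, hx₀⟩
  · exact ⟨0, by simp⟩
  obtain ⟨ε, hε, hball⟩ := Metric.isOpen_iff.1 hU x₀ hx₀
  let B : ContDiffBump x₀ := ⟨ε / 4, ε / 2, by positivity, by linarith⟩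
  let ψ : ℝ → ℝ := B.normed volume
  have hψ1 : ContDiff ℝ ∞ ψ := B.contDiff_normed
  have hψ2 : HasCompactSupport ψ := B.hasCompactSupport_normed
  have hψs : tsupport ψ = Metric.closedBall x₀ (ε / 2) := B.tsupport_normed_eq
  have hψ3 : tsupport ψ ⊆ U := by
    rw [hψs]
    exact (Metric.closedBall_subset_ball (by linarith)).trans hball
  have hψi : ∫ x, ψ x = 1 := B.integral_normed
  -- As ψ has integral one, the constant can only be the ψ-weighted mean of `f`.
  refine ⟨∫ x, ψ x • f x, ?_⟩
  have key := hU.ae_eq_zero_of_integral_contDiff_smul_eq_zero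
    (f := fun x => f x - ∫ x, ψ x • f x) (μ := volume)
    (h.1.sub ((locallyIntegrable_const _).locallyIntegrableOn U)) fun φ h1 h2 h3 => by
      set m : ℝ := ∫ x, φ x with hm
      -- Subtracting mψ makes the mean zero, so the primitive θ of χ has compact support and is an
      -- admissible test function with derivative χ.
      let χ : ℝ → ℝ := fun x => φ x - m * ψ x
      have hχ : ContDiff ℝ ∞ χ := h1.sub (contDiff_const.mul hψ1)
      have hφi : Integrable φ := h1.continuous.integrable_of_hasCompactSupport h2
      have hψint : Integrable ψ := hψ1.continuous.integrable_of_hasCompactSupport hψ2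
      have hχi : ∫ x, χ x = 0 := by
        rw [integral_sub hφi (hψint.const_mul m), integral_const_mul, hψi, ← hm]; ring
      have hK : IsCompact (tsupport φ ∪ tsupport ψ) := h2.isCompact.union hψ2.isCompact
      have hKne : (tsupport φ ∪ tsupport ψ).Nonempty :=
        ⟨x₀, Or.inr (by rw [hψs]; exact Metric.mem_closedBall_self (by linarith))⟩
      have hKU : tsupport φ ∪ tsupport ψ ⊆ U := union_subset h3 hψ3
      obtain ⟨a, haK, ha⟩ := hK.exists_isLeast hKne
      obtain ⟨b, hbK, hb⟩ := hK.exists_isGreatest hKne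
      -- Here `U` must be an interval: θ need not vanish between the supports of φ and ψ.
      have hab : Icc a b ⊆ U := hc.out (hKU haK) (hKU hbK)
      have hχ0 : ∀ x, x ∉ Icc a b → χ x = 0 := fun x hx => by
        have hn : x ∉ tsupport φ ∪ tsupport ψ := fun hxK => hx ⟨ha hxK, hb hxK⟩
        rw [mem_union, not_or] at hn
        simp only [χ, image_eq_zero_of_notMem_tsupport hn.1, image_eq_zero_of_notMem_tsupport hn.2]
        ring
      -- Starting at a - 1 rather than a puts all of [a, b] inside the half-open interval (a - 1, x]
      -- when x > b.
      obtain ⟨hθ, hθ'⟩ := contDiff_integral hχ (a - 1)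
      set θ : ℝ → ℝ := fun x => ∫ t in (a - 1)..x, χ t with hθdef
      have hθ0 : ∀ x, x ∉ Icc a b → θ x = 0 := fun x hx => by
        rw [mem_Icc, not_and_or, not_le, not_le] at hx
        rcases hx with hx | hx
        · have : ∀ t ∈ uIcc (a - 1) x, χ t = 0 := fun t ht => by
            apply hχ0
            have : t ≤ max (a - 1) x := ht.2
            have : max (a - 1) x < a := max_lt (by linarith) hx
            rintro ⟨h, -⟩; linarith
          simp only [hθdef]
          rw [intervalIntegral.integral_congr this]; simp
        · simp only [hθdef]
          rw [intervalIntegral.integral_eq_integral_of_support_subset, hχi]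
          intro t ht
          have : t ∈ Icc a b := by by_contra hn; exact ht (hχ0 t hn)
          exact ⟨by linarith [this.1], by linarith [this.2]⟩
      have hts : tsupport θ ⊆ Icc a b :=
        closure_minimal (fun x hx => by by_contra hn; exact hx (hθ0 x hn)) isClosed_Icc
      have := h.2.2 θ hθ (isCompact_Icc.of_isClosed_subset (isClosed_tsupport θ) hts)
        (hts.trans hab)
      rw [hθ'] at this
      simp only [smul_zero, integral_zero, neg_zero, χ, sub_smul, mul_smul] at this
      have j1 := integrable_smul_of_tsupport_subset h.1 h1.continuous h2 h3
      have j2 := integrable_smul_of_tsupport_subset h.1 hψ1.continuous hψ2 hψ3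
      rw [integral_sub (g := fun x => m • ψ x • f x) j1 (j2.smul m), integral_smul] at this
      simp only [smul_sub]
      rw [integral_sub j1 (hφi.smul_const _), integral_smul_const, ← hm]
      exact this
  filter_upwards [key] with x hx hxU using sub_eq_zero.1 (hx hxU)

/-- A function with weak derivative `g` on an open interval is almost everywhere equal to a
primitive of `g`, up to a constant. -/
theorem HasWeakDeriv.ae_eq_primitive {U : Set ℝ} (hU : IsOpen U) (hc : U.OrdConnected)
    {f G g : ℝ → ℂ} (h : HasWeakDeriv U f g) (hG : IsPrimitive G g) :
    ∃ C : ℂ, ∀ᵐ x, x ∈ U → f x = G x + C := by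
  have h0 := h.sub (hG.hasWeakDeriv U)
  simp only [sub_self] at h0
  obtain ⟨C, hC⟩ := h0.ae_const hU hc
  exact ⟨C, hC.mono fun x hx hxU => by rw [← hx hxU]; ring⟩

theorem HasWeakDeriv.exists_isPrimitive {f g : ℝ → ℂ} (h : HasWeakDeriv univ f g) :
    ∃ F, IsPrimitive F g ∧ f =ᵐ[volume] F := by
  have hG := isPrimitive_integral (locallyIntegrableOn_univ.1 h.2.1) 0
  obtain ⟨C, hC⟩ := h.ae_eq_primitive isOpen_univ ordConnected_univ hG
  exact ⟨_, hG.add_const C, hC.mono fun x hx => hx (mem_univ x)⟩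

/-! ### Functions that are piecewise primitives on the cells of the lattice -/

section Lattice

variable {L : ℝ}

theorem ae_notMem_latticeSet (L : ℝ) : ∀ᵐ x : ℝ, x ∉ latticeSet L :=
  (countable_range _).ae_notMem volume

theorem restrict_latticeSet_compl (L : ℝ) :
    (volume : Measure ℝ).restrict (latticeSet L)ᶜ = volume :=
  Measure.restrict_eq_self_of_ae_mem (ae_notMem_latticeSet L)

theorem floor_div_eq_of_mem (hL : 0 < L) {n : ℤ} {x : ℝ}
    (hx : x ∈ Ico ((n : ℝ) * L) ((n + 1) * L)) : ⌊x / L⌋ = n := by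
  rw [Int.floor_eq_iff, le_div_iff₀ hL, div_lt_iff₀ hL]
  exact hx

theorem mem_Ico_floor_div (hL : 0 < L) (x : ℝ) :
    x ∈ Ico ((⌊x / L⌋ : ℝ) * L) ((⌊x / L⌋ + 1) * L) := by
  rw [mem_Ico, ← le_div_iff₀ hL, ← div_lt_iff₀ hL]
  exact ⟨Int.floor_le _, Int.lt_floor_add_one _⟩

theorem mem_Ioo_floor_div (hL : 0 < L) {x : ℝ} (hx : x ∉ latticeSet L) :
    x ∈ Ioo ((⌊x / L⌋ : ℝ) * L) ((⌊x / L⌋ + 1) * L) := by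
  have h := mem_Ico_floor_div hL x
  exact ⟨lt_of_le_of_ne h.1 fun he => hx ⟨_, he⟩, h.2⟩

theorem Ioo_subset_latticeSet_compl (hL : 0 < L) (n : ℤ) :
    Ioo ((n : ℝ) * L) ((n + 1) * L) ⊆ (latticeSet L)ᶜ := by
  rintro x hx ⟨m, rfl⟩
  have h1 : (n : ℝ) < m := lt_of_mul_lt_mul_right hx.1 hL.le
  have h2 : (m : ℝ) < n + 1 := lt_of_mul_lt_mul_right hx.2 hL.le
  have h3 : n < m := by exact_mod_cast h1
  have h4 : m < n + 1 := by exact_mod_cast h2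
  omega

theorem hasSum_integral_lattice {E : Type*} [NormedAddCommGroup E] [NormedSpace ℝ E]
    (hL : 0 < L) {f : ℝ → E} (hf : Integrable f) :
    HasSum (fun n : ℤ => ∫ x in ((n : ℝ) * L)..((n + 1) * L), f x) (∫ x, f x) := by
  have h := hasSum_integral_iUnion (μ := volume) (f := f) (fun n : ℤ => measurableSet_Ioc)
    (pairwise_disjoint_Ioc_zsmul L) hf.integrableOn
  rw [iUnion_Ioc_zsmul hL, Measure.restrict_univ] at h
  convert h using 2 with n
  rw [intervalIntegral.integral_of_le (by nlinarith)]
  simp [zsmul_eq_mul]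

theorem continuousOn_floor_step (hL : 0 < L) (c : ℤ → ℂ) :
    ContinuousOn (fun x : ℝ => c ⌊x / L⌋) (latticeSet L)ᶜ := by
  intro x hx
  have hm := mem_Ioo_floor_div hL hx
  refine ContinuousAt.continuousWithinAt ?_
  have : (fun y : ℝ => c ⌊y / L⌋) =ᶠ[𝓝 x] fun _ => c ⌊x / L⌋ := by
    filter_upwards [Ioo_mem_nhds hm.1 hm.2] with y hy
    rw [floor_div_eq_of_mem hL (Ioo_subset_Ico_self hy)]
  exact this.continuousAt

/-- Agreement on the open cell suffices, which matters because the floor jumps at the right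
endpoint. -/
theorem integral_congr_cell (hL : 0 < L) {E : Type*} [NormedAddCommGroup E] [NormedSpace ℝ E]
    {f f' : ℝ → E} (n : ℤ) (h : ∀ x ∈ Ioo ((n : ℝ) * L) ((n + 1) * L), f x = f' x) :
    ∫ x in ((n : ℝ) * L)..((n + 1) * L), f x = ∫ x in ((n : ℝ) * L)..((n + 1) * L), f' x := by
  have hle : (n : ℝ) * L ≤ (n + 1) * L := by nlinarith
  rw [intervalIntegral.integral_of_le hle, intervalIntegral.integral_of_le hle,
    integral_Ioc_eq_integral_Ioo, integral_Ioc_eq_integral_Ioo]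
  exact setIntegral_congr_fun measurableSet_Ioo h

/-- A test function supported off the lattice vanishes at both ends of each cell, so its derivative
integrates to zero there. -/
theorem hasWeakDeriv_floor_step (hL : 0 < L) (c : ℤ → ℂ) :
    HasWeakDeriv (latticeSet L)ᶜ (fun x : ℝ => c ⌊x / L⌋) (fun _ => 0) := by
  have hU := (isClosed_latticeSet hL).isOpen_compl
  have hl : LocallyIntegrableOn (fun x : ℝ => c ⌊x / L⌋) (latticeSet L)ᶜ :=
    (continuousOn_floor_step hL c).locallyIntegrableOn hU.measurableSet
  refine ⟨hl, locallyIntegrableOn_zero, fun φ h1 h2 h3 => ?_⟩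
  have hc : Continuous (deriv φ) := h1.continuous_deriv (by simp)
  have hi := integrable_smul_of_tsupport_subset hl hc h2.deriv (tsupport_deriv_subset.trans h3)
  have hs := hasSum_integral_lattice hL hi
  have hz : ∀ n : ℤ, φ ((n : ℝ) * L) = 0 := fun n =>
    image_eq_zero_of_notMem_tsupport fun hn => h3 hn ⟨n, rfl⟩
  have h0 : ∀ n : ℤ, ∫ x in ((n : ℝ) * L)..((n + 1) * L), deriv φ x • c ⌊x / L⌋ = 0 := fun n => by
    rw [integral_congr_cell hL (f' := fun x => deriv φ x • c n) n fun x hx => by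
      rw [floor_div_eq_of_mem hL (Ioo_subset_Ico_self hx)], intervalIntegral.integral_smul_const,
      intervalIntegral.integral_deriv_eq_sub
      (fun t _ => (h1.differentiable (by simp)).differentiableAt) (hc.intervalIntegrable _ _), hz]
    have := hz (n + 1)
    push_cast at this
    rw [this]; simp
  simp only [h0] at hs
  rw [hs.unique hasSum_zero]
  simp

/-- The function `G + c_⌊x/L⌋` has weak derivative `G'` off the lattice. -/
theorem IsPrimitive.hasWeakDeriv_add_step (hL : 0 < L) {G g : ℝ → ℂ} (hG : IsPrimitive G g)
    (c : ℤ → ℂ) : HasWeakDeriv (latticeSet L)ᶜ (fun x => G x + c ⌊x / L⌋) g := by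
  simpa using (hG.hasWeakDeriv _).add (hasWeakDeriv_floor_step hL c)

/-- A function with weak derivative `g` off the lattice is a primitive of `g` plus a function which
is constant on the cells of the lattice. -/
theorem HasWeakDeriv.exists_add_step (hL : 0 < L) {f G g : ℝ → ℂ}
    (h : HasWeakDeriv (latticeSet L)ᶜ f g) (hG : IsPrimitive G g) :
    ∃ c : ℤ → ℂ, f =ᵐ[volume] fun x => G x + c ⌊x / L⌋ := by
  choose c hc using fun n : ℤ => (h.mono (Ioo_subset_latticeSet_compl hL n)).ae_eq_primitive
    isOpen_Ioo ordConnected_Ioo hG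
  refine ⟨c, ?_⟩
  filter_upwards [ae_all_iff.2 hc, ae_notMem_latticeSet L] with x hx hxL
  exact hx _ (mem_Ioo_floor_div hL hxL)

/-- Just left of nL the floor is n - 1, and `G` is continuous, so only the step contributes. -/
theorem hasJumps_add_step (hL : 0 < L) {G : ℝ → ℂ} (hG : Continuous G) (c : ℤ → ℂ) :
    HasJumps L (fun x => G x + c ⌊x / L⌋) (fun n => c n - c (n - 1)) := by
  refine ⟨_, EventuallyEq.rfl, hG.continuousOn.add (continuousOn_floor_step hL c), fun n =>
    ⟨G (n * L) + c n, G (n * L) + c (n - 1), ?_, ?_, by ring⟩⟩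
  · refine ((hG.tendsto _).mono_left nhdsWithin_le_nhds).add (tendsto_const_nhds.congr' ?_)
    filter_upwards [Ioo_mem_nhdsGT (show (n : ℝ) * L < (n + 1) * L by nlinarith)] with x hx
    rw [floor_div_eq_of_mem hL (Ioo_subset_Ico_self hx)]
  · refine ((hG.tendsto _).mono_left nhdsWithin_le_nhds).add (tendsto_const_nhds.congr' ?_)
    filter_upwards [Ioo_mem_nhdsLT (show ((n : ℝ) - 1) * L < n * L by nlinarith)] with x hx
    rw [floor_div_eq_of_mem hL (n := n - 1)]
    push_cast
    rw [sub_add_cancel]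
    exact Ioo_subset_Ico_self hx

theorem HasJumps.unique (hL : 0 < L) {f : ℝ → ℂ} {σ τ : ℤ → ℂ} (h : HasJumps L f σ)
    (h' : HasJumps L f τ) (n : ℤ) : σ n = τ n := by
  have h0 := (h.add (h'.const_mul (-1))).eq_zero hL (Eventually.of_forall fun x => by simp) n
  linear_combination h0

theorem HasLatticeValues.eq_of_ae_eq {f F : ℝ → ℂ} {ζ : ℤ → ℂ} (h : HasLatticeValues L f ζ)
    (hF : Continuous F) (hf : f =ᵐ[volume] F) (n : ℤ) : F (n * L) = ζ n := by
  obtain ⟨u, h1, h2, h3⟩ := h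
  rw [← h3, (h2.ae_eq_iff_eq volume hF).1 (h1.trans hf)]

/-! ### Sign sums, the regular part and Green's formula -/

theorem sign_sub_lattice (hL : 0 < L) {n m : ℤ} {x : ℝ}
    (hx : x ∈ Ioo ((n : ℝ) * L) ((n + 1) * L)) :
    Real.sign (x - m * L) = if m ≤ n then 1 else -1 := by
  split_ifs with h
  · have : (m : ℝ) ≤ n := by exact_mod_cast h
    exact Real.sign_of_pos (by nlinarith [hx.1])
  · have : (n : ℝ) + 1 ≤ m := by exact_mod_cast not_le.1 h
    exact Real.sign_of_neg (by nlinarith [hx.2])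

/-- The sum subtracted in the regular part. -/
noncomputable def signSum (L : ℝ) (σ : ℤ → ℂ) (x : ℝ) : ℂ :=
  1 / 2 * ∑' n : ℤ, σ n * ((Real.sign (x - (n : ℝ) * L) - Real.sign (0 - (n : ℝ) * L) : ℝ) : ℂ)

/-- The normalising constants sgn(0 - nL) cancel in differences, so the base point 0 plays no role
from here on. -/
theorem signSum_sub (hL : 0 < L) (σ : ℤ → ℂ) (x y : ℝ) : signSum L σ x - signSum L σ y =
    1 / 2 * ∑' n : ℤ, σ n * ((Real.sign (x - (n : ℝ) * L) - Real.sign (y - (n : ℝ) * L) : ℝ) : ℂ) := by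
  rw [signSum, signSum, ← mul_sub, ← (summable_regularPart hL σ x).tsum_sub
    (summable_regularPart hL σ y)]
  congr 2
  funext n
  push_cast
  ring

/-- The sum subtracted in the regular part of a function with jumps `c n - c (n - 1)` equals, up to
a constant, the piecewise constant function with values `c n`. -/
theorem exists_signSum_eq (hL : 0 < L) {σ c : ℤ → ℂ} (hσ : ∀ n, σ n = c n - c (n - 1)) :
    ∃ k : ℂ, ∀ x, x ∉ latticeSet L → signSum L σ x = c ⌊x / L⌋ + k := by
  have hsame : ∀ {n : ℤ} {x y : ℝ}, x ∈ Ioo ((n : ℝ) * L) ((n + 1) * L) →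
      y ∈ Ioo ((n : ℝ) * L) ((n + 1) * L) → signSum L σ x = signSum L σ y := by
    intro n x y hx hy
    rw [← sub_eq_zero, signSum_sub hL]
    simp [sign_sub_lattice hL hx, sign_sub_lattice hL hy]
  -- Between neighbouring cells only the sign belonging to the common endpoint flips, from -1 to 1;
  -- the factor 1/2 turns this into one jump.
  have hstep : ∀ {n : ℤ} {x y : ℝ}, x ∈ Ioo (((n + 1 : ℤ) : ℝ) * L) (((n + 1 : ℤ) + 1) * L) →
      y ∈ Ioo ((n : ℝ) * L) ((n + 1) * L) → signSum L σ x - signSum L σ y = σ (n + 1) := by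
    intro n x y hx hy
    rw [signSum_sub hL, tsum_eq_single (n + 1)]
    · rw [sign_sub_lattice hL hx, sign_sub_lattice hL hy]
      simp
      ring
    · intro m hm
      rw [sign_sub_lattice hL hx, sign_sub_lattice hL hy]
      have : m ≤ n + 1 ↔ m ≤ n := by omega
      simp [this]
  have hmid : ∀ n : ℤ, ((n : ℝ) * L + L / 2) ∈ Ioo ((n : ℝ) * L) ((n + 1) * L) := fun n =>
    ⟨by linarith, by linarith⟩
  have hconst : ∀ n : ℤ, signSum L σ ((n : ℝ) * L + L / 2) - c n
      = signSum L σ (((0 : ℤ) : ℝ) * L + L / 2) - c 0 := by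
    have hs : ∀ n : ℤ, signSum L σ (((n + 1 : ℤ) : ℝ) * L + L / 2) - c (n + 1)
        = signSum L σ ((n : ℝ) * L + L / 2) - c n := fun n => by
      have h1 := hstep (hmid (n + 1)) (hmid n)
      rw [hσ, add_sub_cancel_right] at h1
      linear_combination h1
    intro n
    induction n using Int.induction_on with
    | zero => rfl
    | succ n ih => rw [hs, ih]
    | pred n ih => rw [← hs, sub_add_cancel, ih]
  refine ⟨signSum L σ (((0 : ℤ) : ℝ) * L + L / 2) - c 0, fun x hx => ?_⟩
  rw [hsame (mem_Ioo_floor_div hL hx) (hmid _), ← hconst ⌊x / L⌋]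
  ring

/-- The sign sum cancels the step function up to a constant. This is why the regular part has a weak
derivative across the lattice, with no point masses. -/
theorem exists_regularPart_ae_eq (hL : 0 < L) {σ c : ℤ → ℂ} (hσ : ∀ n, σ n = c n - c (n - 1))
    {f G : ℝ → ℂ} (hf : f =ᵐ[volume] fun x => G x + c ⌊x / L⌋) :
    ∃ k : ℂ, regularPart L σ f =ᵐ[volume] fun x => G x + k := by
  obtain ⟨k, hk⟩ := exists_signSum_eq hL hσ
  refine ⟨-k, ?_⟩
  filter_upwards [hf, ae_notMem_latticeSet L] with x hx hxL
  have := hk x hxL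
  rw [signSum] at this
  rw [regularPart, this, hx]
  ring

/-- Green's formula: integration by parts for the product of an absolutely continuous function
and a function with jumps at the points of the lattice. -/
theorem hasSum_green (hL : 0 < L) {V v G g : ℝ → ℂ} {c : ℤ → ℂ} (hV : IsPrimitive V v)
    (hG : IsPrimitive G g) (h0 : Integrable fun x => V x * (G x + c ⌊x / L⌋))
    (h1 : Integrable fun x => v x * (G x + c ⌊x / L⌋) + V x * g x) :
    HasSum (fun n : ℤ => V (n * L) * (c n - c (n - 1)))
      (-∫ x, (v x * (G x + c ⌊x / L⌋) + V x * g x)) := by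
  set h' : ℝ → ℂ := fun x => v x * (G x + c ⌊x / L⌋) + V x * g x with hh'
  have hle : ∀ n : ℤ, (n : ℝ) * L ≤ (n + 1) * L := fun n => by nlinarith
  have hprim : ∀ n : ℤ, IsPrimitive (fun x => V x * (G x + c n))
      (fun x => v x * (G x + c n) + V x * g x) := fun n => hV.mul (hG.add_const (c n))
  have heq : ∀ n : ℤ, ∀ x ∈ Ioo ((n : ℝ) * L) ((n + 1) * L),
      h' x = v x * (G x + c n) + V x * g x := fun n x hx => by
    simp only [hh']
    rw [floor_div_eq_of_mem hL (Ioo_subset_Ico_self hx)]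
  -- Right-hand limit of the product at nL.
  let b : ℤ → ℂ := fun n => V (n * L) * (G (n * L) + c n)
  have hcell : ∀ n : ℤ, ∫ x in ((n : ℝ) * L)..((n + 1) * L), h' x
      = V ((n + 1) * L) * (G ((n + 1) * L) + c n) - b n := fun n => by
    rw [integral_congr_cell hL n (heq n), (hprim n).integral_eq]
  -- Within a cell the product differs from `b n` by at most the integral of the norm of its
  -- derivative. Averaging over the cell bounds `b n` by cell integrals of two integrable functions,
  -- so `b` is summable.
  have hbound : ∀ n : ℤ, L * ‖b n‖ ≤
      (∫ x in ((n : ℝ) * L)..((n + 1) * L), ‖V x * (G x + c ⌊x / L⌋)‖)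
        + L * ∫ x in ((n : ℝ) * L)..((n + 1) * L), ‖h' x‖ := fun n => by
    set N := ∫ x in ((n : ℝ) * L)..((n + 1) * L), ‖h' x‖ with hN
    have hpt : ∀ x ∈ Ioo ((n : ℝ) * L) ((n + 1) * L), ‖b n‖ - N ≤ ‖V x * (G x + c ⌊x / L⌋)‖ := by
      intro x hx
      have e1 := (hprim n).integral_eq (n * L) x
      have e2 : ‖∫ t in ((n : ℝ) * L)..x, (v t * (G t + c n) + V t * g t)‖ ≤ N := by
        refine (intervalIntegral.norm_integral_le_integral_norm hx.1.le).trans ?_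
        rw [hN, integral_congr_cell hL n (fun x hx => by rw [heq n x hx])]
        exact intervalIntegral.integral_mono_interval le_rfl hx.1.le hx.2.le
          (Eventually.of_forall fun t => norm_nonneg _)
          ((hprim n).locallyIntegrable.intervalIntegrable_real _ _).norm
      rw [floor_div_eq_of_mem hL (Ioo_subset_Ico_self hx)]
      have e3 : b n = V x * (G x + c n)
          - ∫ t in ((n : ℝ) * L)..x, (v t * (G t + c n) + V t * g t) := by
        rw [e1]; simp only [b]; ring
      have := norm_sub_le (V x * (G x + c n))
        (∫ t in ((n : ℝ) * L)..x, (v t * (G t + c n) + V t * g t))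
      rw [← e3] at this
      linarith
    have hm : ∫ x in ((n : ℝ) * L)..((n + 1) * L), (‖b n‖ - N) ≤
        ∫ x in ((n : ℝ) * L)..((n + 1) * L), ‖V x * (G x + c ⌊x / L⌋)‖ :=
      intervalIntegral.integral_mono_on_of_le_Ioo (hle n) intervalIntegrable_const
        h0.norm.intervalIntegrable hpt
    rw [intervalIntegral.integral_const, smul_eq_mul] at hm
    have : ((n : ℝ) + 1) * L - n * L = L := by ring
    rw [this] at hm
    linarith
  have hbsum : Summable b := by
    refine Summable.of_norm_bounded (g := fun n : ℤ => L⁻¹ *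
      ((∫ x in ((n : ℝ) * L)..((n + 1) * L), ‖V x * (G x + c ⌊x / L⌋)‖)
        + L * ∫ x in ((n : ℝ) * L)..((n + 1) * L), ‖h' x‖)) ?_ fun n => ?_
    · exact ((hasSum_integral_lattice hL h0.norm).summable.add
        ((hasSum_integral_lattice hL h1.norm).summable.mul_left L)).mul_left _
    · rw [← div_eq_inv_mul, le_div_iff₀ hL, mul_comm]
      exact hbound n
  obtain ⟨B, hB⟩ := hbsum
  have hB' : HasSum (fun n : ℤ => b (n + 1)) B := (Equiv.addRight (1 : ℤ)).hasSum_iff.2 hB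
  -- The differences b(n+1) - b(n) sum to zero. Subtracting the integral over cell n leaves the jump
  -- term at its right end, number n + 1, whence the shift of index.
  have hfin := (hB'.sub hB).sub (hasSum_integral_lattice hL h1)
  rw [sub_self, zero_sub] at hfin
  rw [← (Equiv.addRight (1 : ℤ)).hasSum_iff]
  have hfun : (fun n : ℤ => V (n * L) * (c n - c (n - 1))) ∘ (Equiv.addRight (1 : ℤ)) =
      fun n => b (n + 1) - b n - ∫ x in ((n : ℝ) * L)..((n + 1) * L), h' x := by
    funext n
    rw [hcell]
    simp only [b, Function.comp, Equiv.coe_addRight, add_sub_cancel_right]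
    push_cast
    ring
  rw [hfun]
  exact hfin

end Lattice

/-! ### The graph of the operator in terms of primitives -/

section Graph

variable {P : AcousticParams}

/-- A description of the pairs in the graph of the operator by primitives: `V` is the continuous
representative of the velocity, and the pressure is `G` plus the constant `c n` on each cell. -/
structure GraphData (Ψ Φ : AcousticSpace P) (σ : ell2Z) (V G : ℝ → ℂ) (c : ℤ → ℂ) : Prop where
  V_prim : IsPrimitive V fun x => -((1 / (P.a ^ 2 * P.ρ₀) : ℝ) : ℂ) * Φ.p x
  G_prim : IsPrimitive G fun x => -((P.ρ₀ : ℝ) : ℂ) * Φ.v x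
  v_eq : Ψ.v =ᵐ[volume] V
  p_eq : Ψ.p =ᵐ[volume] fun x => G x + c ⌊x / P.L⌋
  jump : ∀ n, σ n = c n - c (n - 1)
  value : ∀ n : ℤ, V (n * P.L) = Ψ.z n
  y_eq : Φ.y = Ψ.z
  z_eq : Φ.z = -(((P.K / P.M : ℝ) : ℂ) • Ψ.y) - ((P.S / P.M : ℝ) : ℂ) • σ

theorem IsPrimitive.memHomogeneousH1 {G g : ℝ → ℂ} (hG : IsPrimitive G g) (hg : MemLp g 2) :
    MemHomogeneousH1 G := by
  refine ⟨fun C hC => ?_, g, hg, hG.hasWeakDeriv univ⟩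
  obtain ⟨B, hB⟩ := hC.exists_bound_of_continuousOn hG.continuous.continuousOn
  have : IsFiniteMeasure (volume.restrict C) := ⟨by simpa using hC.measure_lt_top⟩
  exact MemLp.of_bound hG.continuous.aestronglyMeasurable B
    ((ae_restrict_iff' hC.measurableSet).2 (Eventually.of_forall hB))

theorem MemLp.locallyIntegrable_two {g : ℝ → ℂ} (hg : MemLp g 2) : LocallyIntegrable g :=
  hg.locallyIntegrable (by norm_num)

theorem DomainConditions.exists_pressure {Ψ : AcousticSpace P} {σ : ell2Z}
    (h : DomainConditions Ψ σ) : ∃ (G g : ℝ → ℂ) (c : ℤ → ℂ), IsPrimitive G g ∧ MemLp g 2 ∧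
      Ψ.p =ᵐ[volume] (fun x => G x + c ⌊x / P.L⌋) ∧ ∀ n, σ n = c n - c (n - 1) := by
  obtain ⟨-, g, hg, hw⟩ := h.p_mem
  rw [restrict_latticeSet_compl] at hg
  have hG := isPrimitive_integral (MemLp.locallyIntegrable_two hg) 0
  obtain ⟨c, hc⟩ := hw.exists_add_step P.L_pos hG
  exact ⟨_, g, c, hG, hg, hc, h.jumps.unique P.L_pos
    ((hasJumps_add_step P.L_pos hG.continuous c).congr hc)⟩

/-- The action of the operator is defined on all vectors satisfying the domain conditions. -/
theorem DomainConditions.exists_action {Ψ : AcousticSpace P} {σ : ell2Z}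
    (h : DomainConditions Ψ σ) : ∃ Φ, ActionFormula Ψ Φ σ := by
  obtain ⟨G, g, c, hG, hg, hp, hσ⟩ := h.exists_pressure
  obtain ⟨k, hk⟩ := exists_regularPart_ae_eq P.L_pos hσ hp
  obtain ⟨-, dv, hdv, hw⟩ := h.v_mem
  rw [Measure.restrict_univ] at hdv
  have hGk := hG.add_const k
  have m1 : MemLp (fun x => -((P.a ^ 2 * P.ρ₀ : ℝ) : ℂ) * dv x) 2 := hdv.const_mul _
  have m2 : MemLp (fun x => -((1 / P.ρ₀ : ℝ) : ℂ) * g x) 2 := hg.const_mul _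
  refine ⟨AcousticSpace.mk (m1.toLp _) (m2.toLp _) Ψ.z
    (-(((P.K / P.M : ℝ) : ℂ) • Ψ.y) - ((P.S / P.M : ℝ) : ℂ) • σ), ?_⟩
  exact
    { p_eq := ⟨dv, hw, MemLp.coeFn_toLp m1⟩
      p₀_mem := (hGk.memHomogeneousH1 hg).congr hk
      v_eq := ⟨g, (hGk.hasWeakDeriv univ).congr hk EventuallyEq.rfl, MemLp.coeFn_toLp m2⟩
      y_eq := rfl
      z_eq := rfl }

theorem exists_graphData {Ψ Φ : AcousticSpace P} {σ : ell2Z} (h : DomainConditions Ψ σ)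
    (h' : ActionFormula Ψ Φ σ) : ∃ V G c, GraphData Ψ Φ σ V G c := by
  have ha := P.a_pos
  have hρ := P.ρ₀_pos
  obtain ⟨G, g, c, hG, hg, hp, hσ⟩ := h.exists_pressure
  obtain ⟨k, hk⟩ := exists_regularPart_ae_eq P.L_pos hσ hp
  obtain ⟨dv, hw, hΦp⟩ := h'.p_eq
  obtain ⟨V, hV, hvV⟩ := hw.exists_isPrimitive
  obtain ⟨dp, hwp, hΦv⟩ := h'.v_eq
  -- The derivative of the regular part on the line is the derivative of the pressure off the
  -- lattice.
  have hu := hwp.unique isOpen_univ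
    (((hG.add_const k).hasWeakDeriv univ).congr hk EventuallyEq.rfl)
  refine ⟨V, G, c, ?_, ?_, hvV, hp, hσ, h.values.eq_of_ae_eq hV.continuous hvV, h'.y_eq, h'.z_eq⟩
  · refine hV.congr ?_
    filter_upwards [hΦp] with x hx
    have : ((P.a : ℂ)) ≠ 0 := by exact_mod_cast ha.ne'
    have : ((P.ρ₀ : ℂ)) ≠ 0 := by exact_mod_cast hρ.ne'
    rw [hx]
    push_cast
    field_simp
  · refine hG.congr ?_
    filter_upwards [hΦv, hu] with x hx hx'
    have : ((P.ρ₀ : ℂ)) ≠ 0 := by exact_mod_cast hρ.ne'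
    rw [hx, hx' (mem_univ x)]
    push_cast
    field_simp

namespace GraphData

variable {Ψ Φ Ψ' Φ' : AcousticSpace P} {σ σ' : ell2Z} {V G V' G' : ℝ → ℂ} {c c' : ℤ → ℂ}

theorem domainConditions (h : GraphData Ψ Φ σ V G c) : DomainConditions Ψ σ where
  p_mem := by
    have hg : MemLp (fun x => -((P.ρ₀ : ℝ) : ℂ) * Φ.v x) 2 := (Lp.memLp Φ.v).const_mul _
    refine ⟨(Lp.memLp Ψ.p).restrict _, _, hg.restrict _, ?_⟩
    exact (h.G_prim.hasWeakDeriv_add_step P.L_pos c).congr h.p_eq EventuallyEq.rfl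
  v_mem := by
    have hg : MemLp (fun x => -((1 / (P.a ^ 2 * P.ρ₀) : ℝ) : ℂ) * Φ.p x) 2 :=
      (Lp.memLp Φ.p).const_mul _
    exact ⟨(Lp.memLp Ψ.v).restrict _, _, hg.restrict _,
      (h.V_prim.hasWeakDeriv univ).congr h.v_eq EventuallyEq.rfl⟩
  jumps := by
    have := (hasJumps_add_step P.L_pos h.G_prim.continuous c).congr h.p_eq
    rwa [← funext h.jump] at this
  values := ⟨V, h.v_eq.symm, h.V_prim.continuous, h.value⟩

theorem actionFormula (h : GraphData Ψ Φ σ V G c) : ActionFormula Ψ Φ σ := by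
  have ha := P.a_pos
  have hρ := P.ρ₀_pos
  obtain ⟨k, hk⟩ := exists_regularPart_ae_eq P.L_pos h.jump h.p_eq
  have hGk := h.G_prim.add_const k
  have : ((P.a : ℂ)) ≠ 0 := by exact_mod_cast ha.ne'
  have : ((P.ρ₀ : ℂ)) ≠ 0 := by exact_mod_cast hρ.ne'
  refine ⟨⟨_, (h.V_prim.hasWeakDeriv univ).congr h.v_eq EventuallyEq.rfl,
    Eventually.of_forall fun x => ?_⟩, ?_,
    ⟨_, (hGk.hasWeakDeriv univ).congr hk EventuallyEq.rfl, Eventually.of_forall fun x => ?_⟩,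
    h.y_eq, h.z_eq⟩
  · push_cast
    field_simp
  · exact (hGk.memHomogeneousH1 ((Lp.memLp Φ.v).const_mul _)).congr hk
  · push_cast
    field_simp

end GraphData

theorem mem_graph_iff {Ψ Φ : AcousticSpace P} : (Ψ, Φ) ∈ (acousticOperator P).graph ↔
    ∃ σ V G c, GraphData Ψ Φ σ V G c := by
  rw [mem_graph_acousticOperator]
  constructor
  · rintro ⟨σ, h, h'⟩
    exact ⟨σ, exists_graphData h h'⟩
  · rintro ⟨σ, V, G, c, h⟩
    exact ⟨σ, h.domainConditions, h.actionFormula⟩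

/-- The graph also demands an image satisfying the action formula; `DomainConditions.exists_action`
shows that this is no further restriction. -/
theorem mem_domain_iff {Ψ : AcousticSpace P} :
    Ψ ∈ (acousticOperator P).domain ↔ ∃ σ : ell2Z, DomainConditions Ψ σ := by
  rw [LinearPMap.mem_domain_iff]
  constructor
  · rintro ⟨Φ, h⟩
    obtain ⟨σ, h, -⟩ := mem_graph_acousticOperator.1 h
    exact ⟨σ, h⟩
  · rintro ⟨σ, h⟩
    obtain ⟨Φ, h'⟩ := h.exists_action
    exact ⟨Φ, mem_graph_acousticOperator.2 ⟨σ, h, h'⟩⟩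

/-! ### Reality -/

theorem GraphData.conj {Ψ Φ : AcousticSpace P} {σ : ell2Z} {V G : ℝ → ℂ} {c : ℤ → ℂ}
    (h : GraphData Ψ Φ σ V G c) : GraphData Ψ.conj Φ.conj (star σ)
      (fun x => starRingEnd ℂ (V x)) (fun x => starRingEnd ℂ (G x))
      (fun n => starRingEnd ℂ (c n)) where
  V_prim := h.V_prim.star.congr <| by
    filter_upwards [Lp.coeFn_star Φ.p] with x hx
    simp [AcousticSpace.conj, hx]
  G_prim := h.G_prim.star.congr <| by
    filter_upwards [Lp.coeFn_star Φ.v] with x hx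
    simp [AcousticSpace.conj, hx]
  v_eq := by
    filter_upwards [Lp.coeFn_star Ψ.v, h.v_eq] with x hx hx'
    simp [AcousticSpace.conj, hx, hx']
  p_eq := by
    filter_upwards [Lp.coeFn_star Ψ.p, h.p_eq] with x hx hx'
    simp [AcousticSpace.conj, hx, hx']
  jump n := by simp [h.jump]
  value n := by simp [h.value, AcousticSpace.conj]
  y_eq := by simp [h.y_eq, AcousticSpace.conj]
  z_eq := by
    apply lp.ext
    funext n
    simp [h.z_eq, AcousticSpace.conj]

namespace AcousticSpace

theorem IsReal.conj_eq {Ψ : AcousticSpace P} (h : Ψ.IsReal) : Ψ.conj = Ψ := by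
  obtain ⟨h1, h2, h3, h4⟩ := h
  have hc : ∀ w : ℂ, w.im = 0 → star w = w := fun w hw => Complex.conj_eq_iff_im.2 hw
  apply AcousticSpace.ext
  · apply Lp.ext
    filter_upwards [Lp.coeFn_star Ψ.p, h1] with x hx hx'
    exact hx.trans (hc _ hx')
  · apply Lp.ext
    filter_upwards [Lp.coeFn_star Ψ.v, h2] with x hx hx'
    exact hx.trans (hc _ hx')
  · apply lp.ext
    funext n
    exact hc _ (h3 n)
  · apply lp.ext
    funext n
    exact hc _ (h4 n)

theorem isReal_of_conj_eq {Ψ : AcousticSpace P} (h : Ψ.conj = Ψ) : Ψ.IsReal := by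
  have hp : star Ψ.p = Ψ.p := congrArg AcousticSpace.p h
  have hv : star Ψ.v = Ψ.v := congrArg AcousticSpace.v h
  have hy : star Ψ.y = Ψ.y := congrArg AcousticSpace.y h
  have hz : star Ψ.z = Ψ.z := congrArg AcousticSpace.z h
  have hc : ∀ w : ℂ, star w = w → w.im = 0 := fun w hw => Complex.conj_eq_iff_im.1 hw
  refine ⟨?_, ?_, fun n => hc _ ?_, fun n => hc _ ?_⟩
  · filter_upwards [Lp.coeFn_star Ψ.p] with x hx
    rw [hp] at hx
    exact hc _ hx.symm
  · filter_upwards [Lp.coeFn_star Ψ.v] with x hx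
    rw [hv] at hx
    exact hc _ hx.symm
  · rw [← lp.star_apply, hy]
  · rw [← lp.star_apply, hz]

end AcousticSpace

theorem isRealOp_acousticOperator : IsRealOp (acousticOperator P) := by
  have hconj : ∀ {Ψ Φ : AcousticSpace P}, (Ψ, Φ) ∈ (acousticOperator P).graph →
      (Ψ.conj, Φ.conj) ∈ (acousticOperator P).graph := fun h => by
    obtain ⟨σ, V, G, c, h⟩ := mem_graph_iff.1 h
    exact mem_graph_iff.2 ⟨_, _, _, _, h.conj⟩
  refine ⟨fun Ψ hΨ => ?_, fun Ψ hΨ => AcousticSpace.isReal_of_conj_eq ?_⟩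
  · exact LinearPMap.mem_domain_of_mem_graph (hconj ((acousticOperator P).mem_graph ⟨Ψ, hΨ⟩))
  · have h1 := (acousticOperator P).mem_graph Ψ
    -- For real Ψ both the image and its conjugate are images of Ψ, hence equal.
    have h2 := hconj h1
    rw [hΨ.conj_eq] at h2
    exact (LinearPMap.mem_graph_snd_inj _ h2 h1 rfl)

/-! ### Skew-symmetry -/

/-- Green's formula for conj V and p; the integrability hypotheses hold since all products are of
two L² functions. The signs of α and β stay free because the adjoint computation mixes data of `X`,
`W` with data of a test pair. -/
theorem hasSum_inner_green {V G : ℝ → ℂ} {c : ℤ → ℂ} {L α β : ℝ} (hL : 0 < L) {f v p g : L2R}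
    (hV : IsPrimitive V fun x => (α : ℂ) * f x) (hG : IsPrimitive G fun x => (β : ℂ) * g x)
    (hv : v =ᵐ[volume] V) (hp : p =ᵐ[volume] fun x => G x + c ⌊x / L⌋) :
    HasSum (fun n : ℤ => starRingEnd ℂ (V (n * L)) * (c n - c (n - 1)))
      (-((α : ℂ) * inner ℂ f p + (β : ℂ) * inner ℂ v g)) := by
  have i1 : Integrable fun x => inner ℂ (f x) (p x) := L2.integrable_inner f p
  have i2 : Integrable fun x => inner ℂ (v x) (g x) := L2.integrable_inner v g
  have i3 : Integrable fun x => inner ℂ (v x) (p x) := L2.integrable_inner v p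
  have e : (fun x => starRingEnd ℂ ((α : ℂ) * f x) * (G x + c ⌊x / L⌋)
      + starRingEnd ℂ (V x) * ((β : ℂ) * g x)) =ᵐ[volume]
      fun x => (α : ℂ) * inner ℂ (f x) (p x) + (β : ℂ) * inner ℂ (v x) (g x) := by
    filter_upwards [hv, hp] with x h1 h2
    rw [h1, h2]
    simp only [map_mul, Complex.conj_ofReal, RCLike.inner_apply]
    ring
  have i4 := (i1.const_mul (α : ℂ)).add (i2.const_mul (β : ℂ))
  have := hasSum_green hL hV.star hG (c := c) (i3.congr (by
    filter_upwards [hv, hp] with x h1 h2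
    rw [h1, h2, RCLike.inner_apply, mul_comm])) (i4.congr e.symm)
  rwa [integral_congr_ae e, integral_add (i1.const_mul _) (i2.const_mul _), integral_const_mul,
    integral_const_mul, ← L2.inner_def, ← L2.inner_def] at this

theorem GraphData.inner_eq {Ψ Φ Ψ' Φ' : AcousticSpace P} {σ σ' : ell2Z} {V G V' G' : ℝ → ℂ}
    {c c' : ℤ → ℂ} (h : GraphData Ψ Φ σ V G c) (h' : GraphData Ψ' Φ' σ' V' G' c') :
    inner ℂ Ψ.z σ' = ((1 / (P.a ^ 2 * P.ρ₀) : ℝ) : ℂ) * inner ℂ Φ.p Ψ'.p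
      + ((P.ρ₀ : ℝ) : ℂ) * inner ℂ Ψ.v Φ'.v := by
  have h1 := hasSum_inner_green (α := -(1 / (P.a ^ 2 * P.ρ₀))) (β := -P.ρ₀) P.L_pos
    (by simpa using h.V_prim) (by simpa using h'.G_prim) h.v_eq h'.p_eq
  have h2 := lp.hasSum_inner (𝕜 := ℂ) (G := fun _ : ℤ => ℂ) Ψ.z σ'
  have : (fun n : ℤ => inner ℂ (Ψ.z n) (σ' n)) =
      fun n : ℤ => starRingEnd ℂ (V (n * P.L)) * (c' n - c' (n - 1)) := by
    funext n
    rw [RCLike.inner_apply, h.value, h'.jump, mul_comm]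
  rw [this] at h2
  rw [h2.unique h1]
  push_cast
  ring

/-- By `GraphData.inner_eq`, used in both orders, the field terms give ⟨z, σ'⟩ + ⟨σ, z'⟩, which the
oscillator terms with weight (M/S)(S/M) = 1 cancel. -/
theorem inner_add_inner_eq_zero {Ψ Φ Ψ' Φ' : AcousticSpace P}
    (h : (Ψ, Φ) ∈ (acousticOperator P).graph) (h' : (Ψ', Φ') ∈ (acousticOperator P).graph) :
    inner ℂ Φ Ψ' + inner ℂ Ψ Φ' = 0 := by
  obtain ⟨σ, V, G, c, h⟩ := mem_graph_iff.1 h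
  obtain ⟨σ', V', G', c', h'⟩ := mem_graph_iff.1 h'
  have e1 := h.inner_eq h'
  have e2 := congrArg (starRingEnd ℂ) (h'.inner_eq h)
  simp only [map_add, map_mul, Complex.conj_ofReal, inner_conj_symm] at e2
  have hM : (P.M : ℂ) ≠ 0 := by exact_mod_cast P.M_pos.ne'
  have hS : (P.S : ℂ) ≠ 0 := by exact_mod_cast P.S_pos.ne'
  simp only [AcousticSpace.inner_def, AcousticSpace.energyInner, h.y_eq, h'.y_eq, h.z_eq, h'.z_eq,
    inner_sub_left, inner_sub_right, inner_neg_left, inner_neg_right, inner_smul_left,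
    inner_smul_right, Complex.conj_ofReal]
  have c1 : ((P.M / P.S : ℝ) : ℂ) * ((P.K / P.M : ℝ) : ℂ) = ((P.K / P.S : ℝ) : ℂ) := by
    push_cast; field_simp
  have c2 : ((P.M / P.S : ℝ) : ℂ) * ((P.S / P.M : ℝ) : ℂ) = 1 := by
    push_cast; field_simp
  linear_combination (-1 : ℂ) * e1 - e2 - (inner ℂ Ψ.y Ψ'.z + inner ℂ Ψ.z Ψ'.y) * c1
    - (inner ℂ σ Ψ'.z + inner ℂ Ψ.z σ') * c2

end Graph

/-! ### Test vectors -/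

section TestVectors

variable {P : AcousticParams}

theorem memLp_two_ofReal {φ : ℝ → ℝ} (hc : Continuous φ) (hs : HasCompactSupport φ) :
    MemLp (fun x => (φ x : ℂ)) 2 :=
  (Complex.continuous_ofReal.comp hc).memLp_of_hasCompactSupport
    (hs.comp_left (g := fun t : ℝ => (t : ℂ)) Complex.ofReal_zero)

theorem inner_toLp_ofReal (f : L2R) {φ : ℝ → ℝ} (h : MemLp (fun x => (φ x : ℂ)) 2) :
    inner ℂ f (h.toLp _) = starRingEnd ℂ (∫ x, φ x • f x) := by
  rw [L2.inner_def, ← integral_conj]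
  apply integral_congr_ae
  filter_upwards [h.coeFn_toLp] with x hx
  rw [hx, RCLike.inner_apply, Complex.real_smul, map_mul, Complex.conj_ofReal]

/-- A smooth pressure has no jumps, so φ is unrestricted on the lattice. -/
theorem exists_test_pressure (P : AcousticParams) {φ : ℝ → ℝ} (h1 : ContDiff ℝ ∞ φ)
    (h2 : HasCompactSupport φ) : ∃ Ψ Φ : AcousticSpace P, (Ψ, Φ) ∈ (acousticOperator P).graph ∧
      Ψ.v = 0 ∧ Ψ.y = 0 ∧ Ψ.z = 0 ∧ Φ.p = 0 ∧ Φ.y = 0 ∧ Φ.z = 0 ∧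
      (∀ f : L2R, inner ℂ f Ψ.p = starRingEnd ℂ (∫ x, φ x • f x)) ∧
      ∀ f : L2R, (P.ρ₀ : ℂ) * inner ℂ f Φ.v = - starRingEnd ℂ (∫ x, deriv φ x • f x) := by
  have hρ : (P.ρ₀ : ℂ) ≠ 0 := by exact_mod_cast P.ρ₀_pos.ne'
  have m := memLp_two_ofReal h1.continuous h2
  have m' := memLp_two_ofReal (h1.continuous_deriv (by simp)) h2.deriv
  refine ⟨AcousticSpace.mk (m.toLp _) 0 0 0, AcousticSpace.mk 0 (-(P.ρ₀ : ℂ)⁻¹ • m'.toLp _) 0 0,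
    mem_graph_iff.2 ⟨0, fun _ => 0, fun x => (φ x : ℂ), fun _ => 0, ?_⟩,
    rfl, rfl, rfl, rfl, rfl, rfl, fun f => inner_toLp_ofReal f m, fun f => ?_⟩
  · exact
    { V_prim := IsPrimitive.zero.congr (Eventually.of_forall fun x => by simp)
      G_prim := (IsPrimitive.of_contDiff h1).congr <| by
        filter_upwards [Lp.coeFn_smul (-(P.ρ₀ : ℂ)⁻¹) (m'.toLp _), m'.coeFn_toLp] with x hx hx'
        rw [AcousticSpace.v_mk, hx, Pi.smul_apply, hx', smul_eq_mul]
        field_simp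
      v_eq := Lp.coeFn_zero _ _ _
      p_eq := by simpa using m.coeFn_toLp
      jump := fun n => by simp
      value := fun n => by simp
      y_eq := rfl
      z_eq := by simp }
  · rw [AcousticSpace.v_mk, inner_smul_right, inner_toLp_ofReal f m']
    field_simp

/-- A velocity field forces the oscillator velocities ζ on the lattice. It is used with ζ = 0 and
with ζ a unit vector; the `GraphData` are kept since Green's formula needs the primitive. -/
theorem exists_test_velocity (P : AcousticParams) {φ : ℝ → ℝ} (h1 : ContDiff ℝ ∞ φ)
    (h2 : HasCompactSupport φ) (ζ : ell2Z) (hζ : ∀ n : ℤ, (φ (n * P.L) : ℂ) = ζ n) :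
    ∃ Ψ Φ : AcousticSpace P, GraphData Ψ Φ 0 (fun x => (φ x : ℂ)) (fun _ => 0) (fun _ => 0) ∧
      Ψ.p = 0 ∧ Ψ.y = 0 ∧ Ψ.z = ζ ∧ Φ.v = 0 ∧ Φ.y = ζ ∧ Φ.z = 0 ∧
      (∀ f : L2R, inner ℂ f Ψ.v = starRingEnd ℂ (∫ x, φ x • f x)) ∧
      ∀ f : L2R, ((1 / (P.a ^ 2 * P.ρ₀) : ℝ) : ℂ) * inner ℂ f Φ.p =
        - starRingEnd ℂ (∫ x, deriv φ x • f x) := by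
  have hρ : (P.ρ₀ : ℂ) ≠ 0 := by exact_mod_cast P.ρ₀_pos.ne'
  have ha : (P.a : ℂ) ≠ 0 := by exact_mod_cast P.a_pos.ne'
  have m := memLp_two_ofReal h1.continuous h2
  have m' := memLp_two_ofReal (h1.continuous_deriv (by simp)) h2.deriv
  refine ⟨AcousticSpace.mk 0 (m.toLp _) 0 ζ,
    AcousticSpace.mk (-((P.a : ℂ) ^ 2 * P.ρ₀) • m'.toLp _) 0 ζ 0, ?_,
    rfl, rfl, rfl, rfl, rfl, rfl, fun f => inner_toLp_ofReal f m, fun f => ?_⟩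
  · exact
    { V_prim := (IsPrimitive.of_contDiff h1).congr <| by
        filter_upwards [Lp.coeFn_smul (-((P.a : ℂ) ^ 2 * P.ρ₀)) (m'.toLp _), m'.coeFn_toLp]
          with x hx hx'
        rw [AcousticSpace.p_mk, hx, Pi.smul_apply, hx', smul_eq_mul]
        push_cast
        field_simp
      G_prim := IsPrimitive.zero.congr (Eventually.of_forall fun x => by simp)
      v_eq := m.coeFn_toLp
      p_eq := (Lp.coeFn_zero _ _ _).trans (Eventually.of_forall fun x => by simp)
      jump := fun n => by simp
      value := hζ
      y_eq := rfl
      z_eq := by simp }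
  · rw [AcousticSpace.p_mk, inner_smul_right, inner_toLp_ofReal f m']
    push_cast
    field_simp

theorem mem_graph_test_displacement (P : AcousticParams) (y : ell2Z) :
    ((AcousticSpace.mk 0 0 y 0 : AcousticSpace P),
      (AcousticSpace.mk 0 0 0 (-(((P.K / P.M : ℝ) : ℂ) • y)) : AcousticSpace P)) ∈
      (acousticOperator P).graph := by
  have hz : ∀ k : ℂ, (fun x => k * (0 : L2R) x) =ᵐ[volume] fun _ => 0 := fun k =>
    Eventually.of_forall fun x => by simp
  refine mem_graph_iff.2 ⟨0, fun _ => 0, fun _ => 0, fun _ => 0, ?_⟩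
  exact
    { V_prim := IsPrimitive.zero.congr (hz _)
      G_prim := IsPrimitive.zero.congr (hz _)
      v_eq := Lp.coeFn_zero _ _ _
      p_eq := (Lp.coeFn_zero _ _ _).trans (Eventually.of_forall fun x => by simp)
      jump := fun n => by simp
      value := fun n => by simp
      y_eq := rfl
      z_eq := by simp }

/-- A smooth bump around a point of the lattice that vanishes at all other points. -/
theorem exists_lattice_bump {L : ℝ} (hL : 0 < L) (n : ℤ) : ∃ φ : ℝ → ℝ, ContDiff ℝ ∞ φ ∧
    HasCompactSupport φ ∧ φ (n * L) = 1 ∧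
      ∀ m : ℤ, (φ (m * L) : ℂ) = (lp.single 2 n (1 : ℂ) : ell2Z) m := by
  -- Outer radius L/2 excludes the other lattice points, which are at distance at least L.
  let B : ContDiffBump ((n : ℝ) * L) := ⟨L / 4, L / 2, by positivity, by linarith⟩
  have h1 : B (n * L) = 1 := B.one_of_mem_closedBall (Metric.mem_closedBall_self B.rIn_pos.le)
  refine ⟨B, B.contDiff, B.hasCompactSupport, h1, fun m => ?_⟩
  by_cases hm : m = n
  · subst hm
    rw [h1, lp.single_apply_self]
    simp
  · rw [lp.single_apply_ne _ _ _ hm, B.zero_of_le_dist]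
    · simp
    · have hd : (1 : ℝ) ≤ |(m : ℝ) - n| := by
        have : (1 : ℤ) ≤ |m - n| := Int.one_le_abs (sub_ne_zero.2 hm)
        exact_mod_cast this
      change L / 2 ≤ _
      rw [Real.dist_eq, ← sub_mul, abs_mul, abs_of_pos hL]
      nlinarith

/-- `F` is frozen at its value at `a` on the left. A function cut off at `a` is such a primitive
plus a step. -/
theorem IsPrimitive.comp_max {F f : ℝ → ℂ} (h : IsPrimitive F f) (a : ℝ) :
    IsPrimitive (fun x => F (max x a)) ((Ici a).indicator f) := by
  have hl : LocallyIntegrable ((Ici a).indicator f) := fun x => by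
    obtain ⟨s, hs, hi⟩ := h.locallyIntegrable x
    exact ⟨s, hs, hi.indicator measurableSet_Ici⟩
  refine IsPrimitive.of_base hl a fun y => ?_
  rw [max_self]
  rcases le_total a y with hy | hy
  · rw [max_eq_left hy, ← h.integral_eq]
    refine intervalIntegral.integral_congr fun t ht => ?_
    rw [uIcc_of_le hy] at ht
    exact indicator_of_mem (show t ∈ Ici a from ht.1) f
  · rw [max_eq_right hy, sub_self, intervalIntegral.integral_of_ge hy,
      integral_Ioc_eq_integral_Ioo, setIntegral_congr_fun (g := fun _ => 0) measurableSet_Ioo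
      fun t ht => indicator_of_notMem (fun hm : t ∈ Ici a => not_le.2 ht.2 hm) f]
    simp

/-- A test vector whose pressure has a single unit jump. -/
theorem exists_test_jump (P : AcousticParams) (n : ℤ) :
    ∃ (Ψ Φ : AcousticSpace P) (V G : ℝ → ℂ) (c : ℤ → ℂ),
      GraphData Ψ Φ (lp.single 2 n (1 : ℂ)) V G c ∧
      Ψ.v = 0 ∧ Ψ.y = 0 ∧ Ψ.z = 0 ∧ Φ.p = 0 := by
  have hρ : (P.ρ₀ : ℂ) ≠ 0 := by exact_mod_cast P.ρ₀_pos.ne'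
  obtain ⟨φ, h1, h2, h3, -⟩ := exists_lattice_bump P.L_pos n
  have m := (memLp_two_ofReal h1.continuous h2).indicator
    (measurableSet_Ici (a := (n : ℝ) * P.L))
  have m' := (memLp_two_ofReal (h1.continuous_deriv (by simp)) h2.deriv).indicator
    (measurableSet_Ici (a := (n : ℝ) * P.L))
  refine ⟨AcousticSpace.mk (m.toLp _) 0 0 0,
    AcousticSpace.mk 0 (-(P.ρ₀ : ℂ)⁻¹ • m'.toLp _) 0
      (-(((P.S / P.M : ℝ) : ℂ) • lp.single 2 n (1 : ℂ))),
    -- The pressure is φ cut off to the left of nL. As φ(nL) = 1, the continuous part is 0 on the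
    -- left and φ - 1 on the right; the step restores the 1.
    fun _ => 0, fun x => (φ (max x (n * P.L)) : ℂ) + -1, fun k => if n ≤ k then 1 else 0, ?_,
    rfl, rfl, rfl, rfl⟩
  exact
    { V_prim := IsPrimitive.zero.congr (Eventually.of_forall fun x => by simp)
      G_prim := (((IsPrimitive.of_contDiff h1).comp_max (n * P.L)).add_const (-1)).congr <| by
        filter_upwards [Lp.coeFn_smul (-(P.ρ₀ : ℂ)⁻¹) (m'.toLp _), m'.coeFn_toLp] with x hx hx'
        rw [AcousticSpace.v_mk, hx, Pi.smul_apply, hx', smul_eq_mul]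
        field_simp
      v_eq := Lp.coeFn_zero _ _ _
      p_eq := by
        filter_upwards [m.coeFn_toLp] with x hx
        rw [AcousticSpace.p_mk, hx]
        have hiff : n ≤ ⌊x / P.L⌋ ↔ (n : ℝ) * P.L ≤ x := by
          rw [Int.le_floor, le_div_iff₀ P.L_pos]
        by_cases hxn : (n : ℝ) * P.L ≤ x
        · rw [indicator_of_mem (show x ∈ Ici ((n : ℝ) * P.L) from hxn), if_pos (hiff.2 hxn),
            max_eq_left hxn]
          ring
        · rw [indicator_of_notMem (show x ∉ Ici ((n : ℝ) * P.L) from hxn),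
            if_neg (mt hiff.1 hxn), max_eq_right (not_le.1 hxn).le, h3]
          simp
      jump := fun k => by
        rw [lp.single_apply, Pi.single_apply]
        split_ifs <;> first | omega | simp
      value := fun k => by simp
      y_eq := rfl
      z_eq := by simp }

/-! ### Density of the domain and the adjoint -/

theorem inner_single_one (f : ell2Z) (n : ℤ) :
    inner ℂ f (lp.single 2 n (1 : ℂ)) = starRingEnd ℂ (f n) := by
  have := lp.inner_single_right (𝕜 := ℂ) (G := fun _ : ℤ => ℂ) n (1 : ℂ) f
  rw [this, RCLike.inner_apply, one_mul]

theorem inner_expand (Ψ Φ : AcousticSpace P) : inner ℂ Ψ Φ =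
    ((1 / (P.a ^ 2 * P.ρ₀) : ℝ) : ℂ) * inner ℂ Ψ.p Φ.p + (P.ρ₀ : ℂ) * inner ℂ Ψ.v Φ.v
      + ((P.K / P.S : ℝ) : ℂ) * inner ℂ Ψ.y Φ.y + ((P.M / P.S : ℝ) : ℂ) * inner ℂ Ψ.z Φ.z := rfl

theorem dense_domain_acousticOperator :
    Dense ((acousticOperator P).domain : Set (AcousticSpace P)) := by
  rw [Submodule.dense_iff_topologicalClosure_eq_top, Submodule.topologicalClosure_eq_top_iff,
    Submodule.eq_bot_iff]
  intro X hX
  have hX : ∀ {Ψ Φ : AcousticSpace P}, (Ψ, Φ) ∈ (acousticOperator P).graph → inner ℂ X Ψ = 0 :=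
    fun h => (Submodule.mem_orthogonal' _ _).1 hX _ (LinearPMap.mem_domain_of_mem_graph h)
  obtain ⟨k1, k2, k3, k4⟩ := AcousticSpace.coeff_pos P
  have hne : ∀ {r : ℝ}, 0 < r → (r : ℂ) ≠ 0 := fun h => by exact_mod_cast h.ne'
  -- Velocities supported off the lattice carry z = 0 and suffice, the lattice being null. Once X.v
  -- = 0 is known, velocity bumps at lattice points detect X.z alone.
  have hXv : X.v = 0 := by
    apply Lp.ext
    refine EventuallyEq.trans ?_ (Lp.coeFn_zero _ _ _).symm
    have := (isClosed_latticeSet P.L_pos).isOpen_compl.ae_eq_zero_of_integral_contDiff_smul_eq_zero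
      ((MemLp.locallyIntegrable_two (Lp.memLp X.v)).locallyIntegrableOn _) fun φ h1 h2 h3 => by
        have hz : ∀ n : ℤ, (φ (n * P.L) : ℂ) = (0 : ell2Z) n := fun n => by
          rw [image_eq_zero_of_notMem_tsupport fun hn => h3 hn ⟨n, rfl⟩]
          simp
        obtain ⟨Ψ, Φ, hg, e1, e2, e3, -, -, -, e4, -⟩ := exists_test_velocity P h1 h2 0 hz
        have := hX (mem_graph_iff.2 ⟨_, _, _, _, hg⟩)
        simpa [inner_expand, e1, e2, e3, e4, P.ρ₀_pos.ne'] using this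
    filter_upwards [this, ae_notMem_latticeSet P.L] with x hx hxL using hx hxL
  apply AcousticSpace.ext
  · apply Lp.ext
    refine EventuallyEq.trans ?_ (Lp.coeFn_zero _ _ _).symm
    apply ae_eq_zero_of_integral_contDiff_smul_eq_zero
      (MemLp.locallyIntegrable_two (Lp.memLp X.p))
    intro φ h1 h2
    obtain ⟨Ψ, Φ, hg, e1, e2, e3, -, -, -, e4, -⟩ := exists_test_pressure P h1 h2
    have := hX hg
    simpa [inner_expand, e1, e2, e3, e4, hne k1, P.a_pos.ne', P.ρ₀_pos.ne'] using this
  · exact hXv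
  · have := hX (mem_graph_test_displacement P X.y)
    refine inner_self_eq_zero (𝕜 := ℂ).1 ?_
    simpa [inner_expand, P.K_pos.ne', P.S_pos.ne', -inner_self_eq_norm_sq_to_K] using this
  · apply lp.ext
    funext n
    obtain ⟨φ, h1, h2, h3, h4⟩ := exists_lattice_bump P.L_pos n
    obtain ⟨Ψ, Φ, hg, e1, e2, e3, -⟩ := exists_test_velocity P h1 h2 _ h4
    have := hX (mem_graph_iff.2 ⟨_, _, _, _, hg⟩)
    simpa [inner_expand, e1, e2, e3, hXv, inner_single_one, P.M_pos.ne', P.S_pos.ne'] using this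

/-- A pair that satisfies the defining relation of the adjoint lies in the graph of the negative
operator. -/
theorem mem_graph_of_inner_eq {X W : AcousticSpace P}
    (h : ∀ {Ψ Φ : AcousticSpace P}, (Ψ, Φ) ∈ (acousticOperator P).graph →
      inner ℂ W Ψ = inner ℂ X Φ) : (X, -W) ∈ (acousticOperator P).graph := by
  have hM : (P.M : ℂ) ≠ 0 := by exact_mod_cast P.M_pos.ne'
  have hS : (P.S : ℂ) ≠ 0 := by exact_mod_cast P.S_pos.ne'
  have hK : (P.K : ℂ) ≠ 0 := by exact_mod_cast P.K_pos.ne'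
  set α : ℝ := 1 / (P.a ^ 2 * P.ρ₀) with hα
  -- Testing with the displacement W.y + X.z makes its squared norm vanish.
  have hWy : W.y = -X.z := by
    rw [← sub_eq_zero, sub_neg_eq_add, ← inner_self_eq_zero (𝕜 := ℂ)]
    have := h (mem_graph_test_displacement P (W.y + X.z))
    simp only [inner_expand, AcousticSpace.p_mk, AcousticSpace.v_mk, AcousticSpace.y_mk,
      AcousticSpace.z_mk, inner_zero_right, mul_zero, add_zero, zero_add, inner_neg_right,
      inner_smul_right] at this
    rw [inner_add_left]
    have c1 : ((P.M / P.S : ℝ) : ℂ) * ((P.K / P.M : ℝ) : ℂ) = ((P.K / P.S : ℝ) : ℂ) := by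
      push_cast; field_simp
    have hKS : ((P.K / P.S : ℝ) : ℂ) ≠ 0 := by push_cast; exact div_ne_zero hK hS
    refine mul_left_cancel₀ hKS ?_
    linear_combination this - inner ℂ X.z (W.y + X.z) * c1
  have hlp : LocallyIntegrable (fun x => (α : ℂ) * W.p x) :=
    MemLp.locallyIntegrable_two ((Lp.memLp W.p).const_mul _)
  have hlv : LocallyIntegrable (fun x => (P.ρ₀ : ℂ) * W.v x) :=
    MemLp.locallyIntegrable_two ((Lp.memLp W.v).const_mul _)
  -- Smooth pressures may cross the lattice, so the weak derivative exists on the whole line and X.v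
  -- has no jumps.
  have hweakv : HasWeakDeriv univ X.v (fun x => (α : ℂ) * W.p x) := by
    refine ⟨(MemLp.locallyIntegrable_two (Lp.memLp X.v)).locallyIntegrableOn _,
      hlp.locallyIntegrableOn _, fun φ h1 h2 _ => ?_⟩
    obtain ⟨Ψ, Φ, hg, e1, e2, e3, e4, e5, e6, e7, e8⟩ :=
      exists_test_pressure P h1 h2
    have := h hg
    simp only [inner_expand, ← hα, e1, e2, e3, e4, e5, e6, e7, e8, inner_zero_right, mul_zero, add_zero,
      zero_add] at this
    have := congrArg (starRingEnd ℂ) this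
    simp only [map_mul, map_neg, Complex.conj_ofReal, Complex.conj_conj] at this
    simp only [← mul_smul_comm]
    rw [integral_const_mul, this, neg_neg]
  obtain ⟨V, hV, hXV⟩ := hweakv.exists_isPrimitive
  -- Against a unit jump at nL, Green's sum is the single term conj(V(nL)), and the only oscillator
  -- term of the test image is -(S/M) times the n-th unit vector.
  have hvalue : ∀ n : ℤ, V (n * P.L) = X.z n := fun n => by
    obtain ⟨Ψ, Φ, V', G', c', hd, e1, e2, e3, e4⟩ := exists_test_jump P n
    have h1 := h (mem_graph_iff.2 ⟨_, _, _, _, hd⟩)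
    have e5 := hd.y_eq
    have e6 := hd.z_eq
    rw [e3] at e5
    rw [e2, smul_zero, neg_zero, zero_sub] at e6
    simp only [inner_expand, ← hα, e1, e2, e3, e4, e5, e6, inner_zero_right, mul_zero, add_zero,
      zero_add, inner_neg_right, inner_smul_right, inner_single_one] at h1
    have h2 := hasSum_inner_green (β := -P.ρ₀) P.L_pos hV (by simpa using hd.G_prim) hXV hd.p_eq
    simp only [← hd.jump] at h2
    have h3 := h2.unique (hasSum_single n fun m hm => by
      rw [lp.single_apply_ne _ _ _ hm, mul_zero])
    rw [lp.single_apply_self, mul_one] at h3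
    have c2 : ((P.M / P.S : ℝ) : ℂ) * ((P.S / P.M : ℝ) : ℂ) = 1 := by
      push_cast; field_simp
    apply (starRingEnd ℂ).injective
    rw [← h3]
    push_cast at h1 c2 ⊢
    linear_combination (-1 : ℂ) * h1 + starRingEnd ℂ (X.z n) * c2
  have hweakp : HasWeakDeriv (latticeSet P.L)ᶜ X.p (fun x => (P.ρ₀ : ℂ) * W.v x) := by
    refine ⟨(MemLp.locallyIntegrable_two (Lp.memLp X.p)).locallyIntegrableOn _,
      hlv.locallyIntegrableOn _, fun φ h1 h2 h3 => ?_⟩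
    have hz : ∀ n : ℤ, (φ (n * P.L) : ℂ) = (0 : ell2Z) n := fun n => by
      rw [image_eq_zero_of_notMem_tsupport fun hn => h3 hn ⟨n, rfl⟩]
      simp
    obtain ⟨Ψ, Φ, hd, e1, e2, e3, e4, e5, e6, e7, e8⟩ :=
      exists_test_velocity P h1 h2 0 hz
    rw [← hα] at e8
    have := h (mem_graph_iff.2 ⟨_, _, _, _, hd⟩)
    simp only [inner_expand, ← hα, e1, e2, e3, e4, e5, e6, e7, e8, inner_zero_right, mul_zero, add_zero,
      zero_add] at this
    have := congrArg (starRingEnd ℂ) this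
    simp only [map_mul, map_neg, Complex.conj_ofReal, Complex.conj_conj] at this
    simp only [← mul_smul_comm]
    rw [integral_const_mul, this, neg_neg]
  have hG := isPrimitive_integral hlv 0
  obtain ⟨c, hc⟩ := hweakp.exists_add_step P.L_pos hG
  -- The candidate σ solves -W.z = -(K/M) X.y - (S/M) σ, so it is in ℓ² from the outset. A velocity
  -- bump at nL isolates the n-th jump of X.p in Green's formula.
  have hjump : ∀ n : ℤ, (((P.M / P.S : ℝ) : ℂ) • W.z - ((P.K / P.S : ℝ) : ℂ) • X.y : ell2Z) n
      = c n - c (n - 1) := fun n => by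
    obtain ⟨φ, h1, h2, h3, h4⟩ := exists_lattice_bump P.L_pos n
    obtain ⟨Ψ, Φ, hd, e1, e2, e3, e4, e5, e6, -⟩ := exists_test_velocity P h1 h2 _ h4
    have i1 := congrArg (starRingEnd ℂ) (h (mem_graph_iff.2 ⟨_, _, _, _, hd⟩))
    simp only [inner_expand, ← hα, e1, e2, e3, e4, e5, e6, inner_zero_right, mul_zero, add_zero,
      zero_add, inner_single_one, map_add, map_mul, Complex.conj_ofReal, Complex.conj_conj,
      inner_conj_symm] at i1
    have i2 := hasSum_inner_green (f := Φ.p) (α := -α) P.L_pos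
      (by simpa [hα] using hd.V_prim) hG hd.v_eq hc
    simp only [h4] at i2
    have i3 := i2.unique (hasSum_single n fun m hm => by
      rw [lp.single_apply_ne _ _ _ hm, map_zero, zero_mul])
    rw [lp.single_apply_self, map_one, one_mul] at i3
    rw [← i3]
    simp only [lp.coeFn_sub, lp.coeFn_smul, Pi.sub_apply, Pi.smul_apply, smul_eq_mul]
    push_cast at i1 ⊢
    linear_combination i1
  refine mem_graph_iff.2 ⟨((P.M / P.S : ℝ) : ℂ) • W.z - ((P.K / P.S : ℝ) : ℂ) • X.y, V,
    fun x => ∫ t in (0 : ℝ)..x, (P.ρ₀ : ℂ) * W.v t, c, ?_⟩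
  exact
    { V_prim := hV.congr <| by
        filter_upwards [Lp.coeFn_neg W.p] with x hx
        change -((α : ℝ) : ℂ) * (-W.p : L2R) x = _
        rw [hx, Pi.neg_apply]
        ring
      G_prim := hG.congr <| by
        filter_upwards [Lp.coeFn_neg W.v] with x hx
        change -(P.ρ₀ : ℂ) * (-W.v : L2R) x = _
        rw [hx, Pi.neg_apply]
        ring
      v_eq := hXV
      p_eq := hc
      jump := hjump
      value := hvalue
      y_eq := by
        change -W.y = _
        rw [hWy, neg_neg]
      z_eq := by
        change -W.z = _
        apply lp.ext
        funext n
        simp only [lp.coeFn_sub, lp.coeFn_smul, lp.coeFn_neg, Pi.sub_apply, Pi.smul_apply,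
          Pi.neg_apply, smul_eq_mul]
        push_cast
        field_simp
        ring }

/-- The test vectors bound the adjoint by the negative operator; skew-symmetry gives the reverse
inclusion. -/
theorem isSkewAdjointOp_acousticOperator : IsSkewAdjointOp (acousticOperator P) := by
  have hd := dense_domain_acousticOperator (P := P)
  refine ⟨hd, le_antisymm (LinearPMap.le_of_le_graph ?_) ?_⟩
  · rintro ⟨X, W⟩ hXW
    rw [LinearPMap.mem_graph_iff] at hXW
    obtain ⟨x, rfl, rfl⟩ := hXW
    have := mem_graph_of_inner_eq (X := x) (W := (acousticOperator P).adjoint x) fun {Ψ Φ} hg => by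
      obtain ⟨u, rfl, rfl⟩ := LinearPMap.mem_graph_iff _ |>.1 hg
      exact LinearPMap.adjoint_isFormalAdjoint hd x u
    rw [LinearPMap.neg_graph, Submodule.mem_map]
    exact ⟨_, this, by simp⟩
  · refine LinearPMap.IsFormalAdjoint.le_adjoint hd fun x y => ?_
    have := inner_add_inner_eq_zero ((acousticOperator P).mem_graph x)
      ((acousticOperator P).mem_graph ⟨y, y.2⟩)
    rw [LinearPMap.neg_apply, inner_neg_right]
    exact eq_neg_of_add_eq_zero_left this

end TestVectors

theorem mainTheorem7 (P : AcousticParams) :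
    (∀ Ψ : AcousticSpace P,
      Ψ ∈ (acousticOperator P).domain ↔ ∃ σ : ell2Z, DomainConditions Ψ σ) ∧
    (∀ Ψ : (acousticOperator P).domain, ∃ σ : ell2Z,
      DomainConditions (Ψ : AcousticSpace P) σ ∧
        ActionFormula (Ψ : AcousticSpace P) (acousticOperator P Ψ) σ) ∧
    IsRealOp (acousticOperator P) ∧
    IsSkewAdjointOp (acousticOperator P) :=
  ⟨fun _ => mem_domain_iff,
    fun Ψ => mem_graph_acousticOperator.1 ((acousticOperator P).mem_graph Ψ),
    isRealOp_acousticOperator, isSkewAdjointOp_acousticOperator⟩
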